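/- Let $\mathbb F$ be an algebraically closed field and $\lambda_0\in\mathbb F$. Conventions: a rational function is *defined at $\lambda_0$* if its denominator in lowest terms does not vanish at $\lambda_0$; a square rational matrix $R(\lambda)$ is *regular at $\lambda_0$* if all its entries are defined at $\lambda_0$ and $\det R(\lambda_0)\neq 0$. For every rational matrix $H(\lambda)\in\mathbb F(\lambda)^{q\times l}$ of rank $r$ over $\mathbb F(\lambda)$ there are rational matrices $R_1(\lambda)\in\mathbb F(\lambda)^{q\times q}$, $R_2(\lambda)\in\mathbb F(\lambda)^{l\times l}$, regular at $\lambda_0$, and integers $\nu_1\le\cdots\le\nu_r$, uniquely determined by $H$ and $\lambda_0$, with $$R_1(\lambda)H(\lambda)R_2(\lambda)=\begin{bmatrix}\operatorname{diag}\big((\lambda-\lambda_0)^{\nu_1},\ldots,(\lambda-\lambda_0)^{\nu_r}\big)&0\\0&0_{(q-r)\times(l-r)}\end{bmatrix}.$$ The *pole elementary divisors* of $H$ at $\lambda_0$ are the polynomials $(\lambda-\lambda_0)^{-\nu_i}$ with $\nu_i<0$, and its *zero elementary divisors* at $\lambda_0$ are the polynomials $(\lambda-\lambda_0)^{\nu_i}$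 with $\nu_i>0$, both listed with repetitions. If $H$ is a polynomial matrix, then all $\nu_i\ge 0$, and the polynomials $(\lambda-\lambda_0)^{\nu_i}$ with $\nu_i\ne0$ (with repetitions) are called the *elementary divisors* of $H$ at $\lambda_0$. **Theorem.** Let $n,p,m\ge 0$, let $A(\lambda)\in\mathbb F[\lambda]^{n\times n}$ with $\det A(\lambda)\not\equiv 0$ (a vacuous condition if $n=0$), $B(\lambda)\in\mathbb F[\lambda]^{n\times m}$, $C(\lambda)\in\mathbb F[\lambda]^{p\times n}$, $D(\lambda)\in\mathbb F[\lambda]^{p\times m}$, and put $$P(\lambda)=\begin{bmatrix}A(\lambda)&B(\lambda)\\-C(\lambda)&D(\lambda)\end{bmatrix}\in\mathbb F[\lambda]^{(n+p)\times(n+m)},\qquad G(\lambda)=D(\lambda)+C(\lambda)A(\lambda)^{-1}B(\lambda)\in\mathbb F(\lambda)^{p\times m}.$$ Suppose that $P$ is minimal at $\lambda_0$, that is, $$\operatorname{rank}\begin{bmatrix}A(\lambda_0)\\C(\lambda_0)\end{bmatrix}=\operatorname{rank}\begin{bmatrix}A(\lambda_0)&B(\lambda_0)\end{bmatrix}=n.$$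 Then the elementary divisors of $A(\lambda)$ at $\lambda_0$ are exactly the pole elementary divisors of $G(\lambda)$ at $\lambda_0$, and the elementary divisors of $P(\lambda)$ at $\lambda_0$ are exactly the zero elementary divisors of $G(\lambda)$ at $\lambda_0$, in both cases counted with repetitions. -/

import Mathlib

open Polynomial

noncomputable section

namespace RationalMatrix

/-! ### Rational functions and rational matrices at a finite point -/

section Local

variable {F : Type*} [Field F]

/-- The rational function `λ - a`. -/
def localParam (a : F) : RatFunc F := RatFunc.X - RatFunc.C a

/-- A rational function is defined at `a` if, in lowest terms, its denominator does not vanish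
at `a`. -/
def DefinedAt (f : RatFunc F) (a : F) : Prop := f.denom.eval a ≠ 0

/-- The value at `a` of a rational matrix (meaningful if the entries are defined at `a`). -/
def evalAt {ι κ : Type*} (R : Matrix ι κ (RatFunc F)) (a : F) : Matrix ι κ F :=
  R.map (RatFunc.eval (RingHom.id F) a)

/-- A square rational matrix `R(λ)` is regular at `a` if it is defined at `a` and
`det R(a) ≠ 0`. -/
def IsRegularAt {ι : Type*} [Fintype ι] [DecidableEq ι] (R : Matrix ι ι (RatFunc F)) (a : F) :
    Prop :=
  (∀ i j, DefinedAt (R i j) a) ∧ (evalAt R a).det ≠ 0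

/-- Equivalence of rational matrices at `a`. -/
def EquivalentAt {ι κ : Type*} [Fintype ι] [DecidableEq ι] [Fintype κ] [DecidableEq κ]
    (G H : Matrix ι κ (RatFunc F)) (a : F) : Prop :=
  ∃ (R₁ : Matrix ι ι (RatFunc F)) (R₂ : Matrix κ κ (RatFunc F)),
    IsRegularAt R₁ a ∧ IsRegularAt R₂ a ∧ R₁ * G * R₂ = H

/-- The `p × m` matrix whose leading diagonal entries are
`(λ - a) ^ ν₁, …, (λ - a) ^ νᵣ` and whose other entries are `0`. -/
def localDiag (p m : ℕ) {r : ℕ} (ν : Fin r → ℤ) (a : F) : Matrix (Fin p) (Fin m) (RatFunc F) :=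
  Matrix.of fun i j =>
    if h : i.val = j.val ∧ i.val < r then localParam a ^ ν ⟨i.val, h.2⟩ else 0

/-- `ν₁ ≤ ⋯ ≤ νᵣ`, with `r` the normal rank of `G`, are the exponents of a local Smith–McMillan
form of `G` at `a`. -/
def IsInvariantOrders {p m : ℕ} (G : Matrix (Fin p) (Fin m) (RatFunc F)) (a : F)
    (ν : Fin G.rank → ℤ) : Prop :=
  Monotone ν ∧ EquivalentAt G (localDiag p m ν a) a

/-! ### Existence of the local Smith–McMillan form -/

theorem definedAt_algebraMap (q : F[X]) (a : F) : DefinedAt (algebraMap F[X] (RatFunc F) q) a := by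
  simp [DefinedAt, RatFunc.denom_algebraMap]

theorem definedAt_of_dvd {f : RatFunc F} {a : F} {q : F[X]} (h : f.denom ∣ q)
    (hq : q.eval a ≠ 0) : DefinedAt f a := by
  obtain ⟨c, rfl⟩ := h
  intro h0
  apply hq
  rw [eval_mul, h0, zero_mul]

/-- The ring of rational functions defined at `a`. -/
def localRing (a : F) : Subring (RatFunc F) where
  carrier := {f | DefinedAt f a}
  mul_mem' {f g} hf hg := definedAt_of_dvd (RatFunc.denom_mul_dvd f g) (by
    rw [eval_mul]; exact mul_ne_zero hf hg)
  one_mem' := by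
    have := definedAt_algebraMap (1 : F[X]) a
    simpa using this
  add_mem' {f g} hf hg := definedAt_of_dvd (RatFunc.denom_add_dvd f g) (by
    rw [eval_mul]; exact mul_ne_zero hf hg)
  zero_mem' := by
    have := definedAt_algebraMap (0 : F[X]) a
    simpa using this
  neg_mem' {f} hf := by
    have h1 : DefinedAt (-1 : RatFunc F) a := by
      have := definedAt_algebraMap (-1 : F[X]) a
      simpa using this
    have h2 : DefinedAt (-1 * f) a := definedAt_of_dvd (RatFunc.denom_mul_dvd (-1) f) (by
      rw [eval_mul]; exact mul_ne_zero h1 hf)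
    simpa using h2

theorem mem_localRing {a : F} {f : RatFunc F} : f ∈ localRing a ↔ DefinedAt f a := Iff.rfl

/-- Evaluation at `a`. -/
def localEval (a : F) : localRing a →+* F where
  toFun f := RatFunc.eval (RingHom.id F) a f
  map_one' := by simp
  map_zero' := by simp
  map_mul' f g := RatFunc.eval_mul (RingHom.id F) a f.2 g.2
  map_add' f g := RatFunc.eval_add (RingHom.id F) a f.2 g.2

theorem localEval_apply (a : F) (f : localRing a) :
    localEval a f = RatFunc.eval (RingHom.id F) a f := rfl

section Regular

variable {ι κ : Type*} [Fintype ι] [DecidableEq ι] [Fintype κ] [DecidableEq κ]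

theorem isRegularAt_iff {R : Matrix ι ι (RatFunc F)} {a : F} :
    IsRegularAt R a ↔ ∃ N : Matrix ι ι (localRing a), N.map (localRing a).subtype = R ∧
      localEval a N.det ≠ 0 := by
  constructor
  · rintro ⟨h1, h2⟩
    refine ⟨Matrix.of fun i j => ⟨R i j, h1 i j⟩, by ext i j; rfl, ?_⟩
    rw [RingHom.map_det]
    exact h2
  · rintro ⟨N, rfl, hN⟩
    refine ⟨fun i j => (N i j).2, ?_⟩
    rw [RingHom.map_det] at hN
    exact hN

theorem IsRegularAt.det_ne_zero {R : Matrix ι ι (RatFunc F)} {a : F} (h : IsRegularAt R a) :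
    R.det ≠ 0 := by
  obtain ⟨N, rfl, hN⟩ := isRegularAt_iff.1 h
  have : (N.map (localRing a).subtype).det = (localRing a).subtype N.det := by
    rw [RingHom.map_det]; rfl
  rw [this]
  intro h0
  have h1 : N.det = 0 := Subtype.ext h0
  rw [h1, map_zero] at hN
  exact hN rfl

theorem IsRegularAt.mul {R S : Matrix ι ι (RatFunc F)} {a : F} (hR : IsRegularAt R a)
    (hS : IsRegularAt S a) : IsRegularAt (R * S) a := by
  obtain ⟨N, rfl, hN⟩ := isRegularAt_iff.1 hR
  obtain ⟨M, rfl, hM⟩ := isRegularAt_iff.1 hS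
  refine isRegularAt_iff.2 ⟨N * M, by rw [Matrix.map_mul], ?_⟩
  rw [Matrix.det_mul, map_mul]
  exact mul_ne_zero hN hM

theorem isRegularAt_one (a : F) : IsRegularAt (1 : Matrix ι ι (RatFunc F)) a :=
  isRegularAt_iff.2 ⟨1, by simp, by simp⟩

theorem IsRegularAt.submatrix {R : Matrix ι ι (RatFunc F)} {a : F} (h : IsRegularAt R a)
    (e : κ ≃ ι) : IsRegularAt (R.submatrix e e) a := by
  refine ⟨fun i j => h.1 _ _, ?_⟩
  have : evalAt (R.submatrix e e) a = (evalAt R a).submatrix e e := rfl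
  rw [this, Matrix.det_submatrix_equiv_self]
  exact h.2

theorem isRegularAt_perm (e : Equiv.Perm ι) (a : F) :
    IsRegularAt ((1 : Matrix ι ι (RatFunc F)).submatrix e id) a := by
  refine isRegularAt_iff.2 ⟨(1 : Matrix ι ι (localRing a)).submatrix e id, ?_, ?_⟩
  · rw [← Matrix.submatrix_map]; simp
  · rw [Matrix.det_permute]
    simp only [Matrix.det_one, mul_one]
    rcases Int.units_eq_one_or (Equiv.Perm.sign e) with h | h <;> simp [h]

theorem isRegularAt_fromBlocks_lower {A : Matrix ι ι (RatFunc F)} {C : Matrix κ ι (RatFunc F)}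
    {D : Matrix κ κ (RatFunc F)} {a : F} (hA : IsRegularAt A a) (hD : IsRegularAt D a)
    (hC : ∀ i j, DefinedAt (C i j) a) : IsRegularAt (Matrix.fromBlocks A 0 C D) a := by
  obtain ⟨N, rfl, hN⟩ := isRegularAt_iff.1 hA
  obtain ⟨M, rfl, hM⟩ := isRegularAt_iff.1 hD
  refine isRegularAt_iff.2
    ⟨Matrix.fromBlocks N 0 (Matrix.of fun i j => ⟨C i j, hC i j⟩) M, ?_, ?_⟩
  · rw [Matrix.fromBlocks_map]
    congr 1
  · rw [Matrix.det_fromBlocks_zero₁₂, map_mul]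
    exact mul_ne_zero hN hM

theorem isRegularAt_fromBlocks_upper {A : Matrix ι ι (RatFunc F)} {B : Matrix ι κ (RatFunc F)}
    {D : Matrix κ κ (RatFunc F)} {a : F} (hA : IsRegularAt A a) (hD : IsRegularAt D a)
    (hB : ∀ i j, DefinedAt (B i j) a) : IsRegularAt (Matrix.fromBlocks A B 0 D) a := by
  obtain ⟨N, rfl, hN⟩ := isRegularAt_iff.1 hA
  obtain ⟨M, rfl, hM⟩ := isRegularAt_iff.1 hD
  refine isRegularAt_iff.2
    ⟨Matrix.fromBlocks N (Matrix.of fun i j => ⟨B i j, hB i j⟩) 0 M, ?_, ?_⟩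
  · rw [Matrix.fromBlocks_map]
    congr 1
  · rw [Matrix.det_fromBlocks_zero₂₁, map_mul]
    exact mul_ne_zero hN hM

theorem EquivalentAt.trans {G H K : Matrix ι κ (RatFunc F)} {a : F} (h : EquivalentAt G H a)
    (h' : EquivalentAt H K a) : EquivalentAt G K a := by
  obtain ⟨R, S, hR, hS, rfl⟩ := h
  obtain ⟨R', S', hR', hS', rfl⟩ := h'
  exact ⟨R' * R, S * S', hR'.mul hR, hS.mul hS', by simp only [Matrix.mul_assoc]⟩

theorem EquivalentAt.reindex {ι' κ' : Type*} [Fintype ι'] [DecidableEq ι'] [Fintype κ']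
    [DecidableEq κ'] {G H : Matrix ι κ (RatFunc F)} {a : F} (h : EquivalentAt G H a)
    (e : ι' ≃ ι) (f : κ' ≃ κ) : EquivalentAt (G.submatrix e f) (H.submatrix e f) a := by
  obtain ⟨R, S, hR, hS, rfl⟩ := h
  refine ⟨R.submatrix e e, S.submatrix f f, hR.submatrix e, hS.submatrix f, ?_⟩
  rw [Matrix.submatrix_mul_equiv, Matrix.submatrix_mul_equiv]

theorem equivalentAt_perm (G : Matrix ι κ (RatFunc F)) (e : Equiv.Perm ι) (f : Equiv.Perm κ)
    (a : F) : EquivalentAt G (G.submatrix e f) a := by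
  refine ⟨(1 : Matrix ι ι (RatFunc F)).submatrix e id,
    (1 : Matrix κ κ (RatFunc F)).submatrix f.symm id, isRegularAt_perm _ _,
    isRegularAt_perm _ _, ?_⟩
  ext i j
  simp [Matrix.mul_apply, Matrix.one_apply, Equiv.symm_apply_eq]

theorem EquivalentAt.fromBlocks {G H : Matrix ι κ (RatFunc F)} {a : F} (h : EquivalentAt G H a)
    (c : Matrix Unit Unit (RatFunc F)) :
    EquivalentAt (Matrix.fromBlocks c 0 0 G) (Matrix.fromBlocks c 0 0 H) a := by
  obtain ⟨R, S, hR, hS, rfl⟩ := h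
  refine ⟨Matrix.fromBlocks 1 0 0 R, Matrix.fromBlocks 1 0 0 S,
    isRegularAt_fromBlocks_lower (isRegularAt_one a) hR (fun _ _ => (localRing a).zero_mem),
    isRegularAt_fromBlocks_lower (isRegularAt_one a) hS (fun _ _ => (localRing a).zero_mem), ?_⟩
  simp [Matrix.fromBlocks_multiply]

theorem EquivalentAt.rank_eq {G H : Matrix ι κ (RatFunc F)} {a : F} (h : EquivalentAt G H a) :
    H.rank = G.rank := by
  obtain ⟨R, S, hR, hS, rfl⟩ := h
  rw [Matrix.rank_mul_eq_left_of_isUnit_det _ _ hS.det_ne_zero.isUnit,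
    Matrix.rank_mul_eq_right_of_isUnit_det _ _ hR.det_ne_zero.isUnit]

end Regular

theorem localParam_eq (a : F) :
    localParam a = algebraMap F[X] (RatFunc F) (Polynomial.X - Polynomial.C a) := by
  simp [localParam]

theorem localParam_ne_zero (a : F) : localParam a ≠ 0 := by
  rw [localParam_eq]
  exact RatFunc.algebraMap_ne_zero <| X_sub_C_ne_zero a

theorem localParam_mem (a : F) : localParam a ∈ localRing a := by
  rw [localParam_eq]; exact definedAt_algebraMap _ _

theorem localParam_zpow_mem (a : F) {k : ℤ} (hk : 0 ≤ k) : localParam a ^ k ∈ localRing a := by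
  lift k to ℕ using hk
  rw [zpow_natCast]
  exact pow_mem (localParam_mem a) k

theorem nonneg_of_localParam_zpow_mem (a : F) {k : ℤ} (h : localParam a ^ k ∈ localRing a) :
    0 ≤ k := by
  by_contra! hk
  have h1 : localEval a ⟨localParam a, localParam_mem a⟩ = 0 := by
    change RatFunc.eval (RingHom.id F) a (localParam a) = 0
    rw [localParam_eq, RatFunc.eval_algebraMap]
    simp
  have h2 : (⟨localParam a, localParam_mem a⟩ : localRing a) *
      (⟨localParam a ^ (-k - 1), localParam_zpow_mem a (by omega)⟩ * ⟨_, h⟩) = 1 := by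
    apply Subtype.ext
    simp only [Subring.coe_mul, Subring.coe_one]
    rw [← zpow_add₀ (localParam_ne_zero a), ← zpow_one_add₀ (localParam_ne_zero a),
      show 1 + (-k - 1 + k) = 0 by ring, zpow_zero]
  have h3 := congrArg (localEval a) h2
  rw [map_mul, h1, zero_mul, map_one] at h3
  exact zero_ne_one h3

/-- Every nonzero rational function is `(λ - a) ^ k` times a unit of the local ring. -/
theorem exists_eq_zpow_mul {f : RatFunc F} (hf : f ≠ 0) (a : F) :
    ∃ (k : ℤ) (u : RatFunc F), u ≠ 0 ∧ u ∈ localRing a ∧ u⁻¹ ∈ localRing a ∧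
      f = localParam a ^ k * u := by
  have key : ∀ q : F[X], q ≠ 0 → ∃ (k : ℕ) (s : F[X]), s.eval a ≠ 0 ∧
      algebraMap F[X] (RatFunc F) q = localParam a ^ k * algebraMap F[X] (RatFunc F) s := by
    intro q hq
    obtain ⟨s, h1, h2⟩ := Polynomial.exists_eq_pow_rootMultiplicity_mul_and_not_dvd q hq a
    refine ⟨q.rootMultiplicity a, s, fun h => h2 (dvd_iff_isRoot.2 h), ?_⟩
    conv_lhs => rw [h1]
    rw [map_mul, map_pow, localParam_eq]
  have key2 : ∀ s t : F[X], t.eval a ≠ 0 →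
      algebraMap F[X] (RatFunc F) s / algebraMap F[X] (RatFunc F) t ∈ localRing a := by
    intro s t ht
    exact definedAt_of_dvd (RatFunc.denom_div_dvd s t) ht
  obtain ⟨k, s, hs, h1⟩ := key f.num (RatFunc.num_ne_zero hf)
  obtain ⟨l, t, ht, h2⟩ := key f.denom f.denom_ne_zero
  have hs0 : algebraMap F[X] (RatFunc F) s ≠ 0 := by
    apply RatFunc.algebraMap_ne_zero; rintro rfl; simp at hs
  have ht0 : algebraMap F[X] (RatFunc F) t ≠ 0 := by
    apply RatFunc.algebraMap_ne_zero; rintro rfl; simp at ht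
  refine ⟨(k : ℤ) - l, algebraMap F[X] (RatFunc F) s / algebraMap F[X] (RatFunc F) t,
    div_ne_zero hs0 ht0, key2 _ _ ht, by rw [inv_div]; exact key2 _ _ hs, ?_⟩
  conv_lhs => rw [← RatFunc.num_div_denom f]
  rw [h1, h2, zpow_sub₀ (localParam_ne_zero a), zpow_natCast, zpow_natCast]
  have := localParam_ne_zero a
  field_simp

/-- The standard bijection `Unit ⊕ Fin p ≃ Fin (p + 1)`. -/
def unitSumEquiv (p : ℕ) : Fin (p + 1) ≃ Unit ⊕ Fin p where
  toFun := Fin.cases (Sum.inl ()) Sum.inr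
  invFun := Sum.elim (fun _ => 0) Fin.succ
  left_inv i := by refine Fin.cases ?_ (fun i => ?_) i <;> simp
  right_inv i := by rcases i with _ | i <;> simp

theorem localDiag_cons (p m : ℕ) {r : ℕ} (k : ℤ) (ν : Fin r → ℤ) (a : F) :
    localDiag (p + 1) (m + 1) (Fin.cons k ν : Fin (r + 1) → ℤ) a =
      (Matrix.fromBlocks (Matrix.of fun _ _ : Unit => localParam a ^ k) 0 0
        (localDiag p m ν a)).submatrix (unitSumEquiv p) (unitSumEquiv m) := by
  ext i j
  refine Fin.cases ?_ (fun i => ?_) i <;> refine Fin.cases ?_ (fun j => ?_) j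
  · have : (⟨0, by omega⟩ : Fin (r + 1)) = 0 := rfl
    simp [localDiag, unitSumEquiv]
  · simp [localDiag, unitSumEquiv]
  · simp [localDiag, unitSumEquiv]
  · simp only [localDiag, unitSumEquiv, Matrix.of_apply, Matrix.submatrix_apply, Equiv.coe_fn_mk,
      Fin.cases_succ, Matrix.fromBlocks_apply₂₂, Fin.val_succ, Nat.add_right_cancel_iff,
      Nat.add_lt_add_iff_right]
    split_ifs with h
    · congr 1
    · rfl

theorem equivalentAt_pivot {p m : ℕ} (G : Matrix (Fin (p + 1)) (Fin (m + 1)) (RatFunc F)) (a : F)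
    (k : ℤ) (u : RatFunc F) (hu0 : u ≠ 0) (hu : u⁻¹ ∈ localRing a)
    (h0 : G 0 0 = localParam a ^ k * u)
    (hG : ∀ i j, localParam a ^ (-k) * G i j ∈ localRing a) :
    ∃ S : Matrix (Fin p) (Fin m) (RatFunc F),
      (∀ i j, localParam a ^ (-k) * S i j ∈ localRing a) ∧
      EquivalentAt G ((Matrix.fromBlocks (Matrix.of fun _ _ : Unit => localParam a ^ k) 0 0
        S).submatrix (unitSumEquiv p) (unitSumEquiv m)) a := by
  have ht := zpow_ne_zero k (localParam_ne_zero a)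
  have hinv : (G 0 0)⁻¹ = localParam a ^ (-k) * u⁻¹ := by
    rw [h0, mul_inv, zpow_neg]
  have hg0 : G 0 0 ≠ 0 := by rw [h0]; exact mul_ne_zero ht hu0
  set y : Matrix Unit (Fin m) (RatFunc F) := Matrix.of fun _ j => -((G 0 0)⁻¹ * G 0 j.succ)
  set x : Matrix (Fin p) Unit (RatFunc F) := Matrix.of fun i _ => -((G 0 0)⁻¹ * G i.succ 0)
  have hq : ∀ i j, (G 0 0)⁻¹ * G i j ∈ localRing a := fun i j => by
    rw [hinv, mul_right_comm]; exact mul_mem (hG i j) hu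
  have hL : IsRegularAt (Matrix.fromBlocks (1 : Matrix Unit Unit (RatFunc F)) 0 x 1) a :=
    isRegularAt_fromBlocks_lower (isRegularAt_one a) (isRegularAt_one a)
      (fun i _ => neg_mem (hq _ _))
  have hU : IsRegularAt (Matrix.fromBlocks (1 : Matrix Unit Unit (RatFunc F)) y 0 1) a :=
    isRegularAt_fromBlocks_upper (isRegularAt_one a) (isRegularAt_one a)
      (fun i _ => neg_mem (hq _ _))
  have hV : IsRegularAt (Matrix.fromBlocks (Matrix.of fun _ _ : Unit => u⁻¹) 0 0
      (1 : Matrix (Fin m) (Fin m) (RatFunc F))) a := by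
    refine isRegularAt_fromBlocks_upper ?_ (isRegularAt_one a)
      (fun i _ => (localRing a).zero_mem)
    refine isRegularAt_iff.2 ⟨Matrix.of fun _ _ => ⟨u⁻¹, hu⟩, rfl, ?_⟩
    rw [Matrix.det_unique]
    simp only [Matrix.of_apply]
    by_cases hu' : u ∈ localRing a
    · intro h
      have h2 : (⟨u⁻¹, hu⟩ : localRing a) * ⟨u, hu'⟩ = 1 := Subtype.ext (inv_mul_cancel₀ hu0)
      have h3 := congrArg (localEval a) h2
      rw [map_mul, h, zero_mul, map_one] at h3
      exact zero_ne_one h3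
    · refine absurd ?_ hu'
      have := hG 0 0
      rwa [h0, ← mul_assoc, zpow_neg, inv_mul_cancel₀ ht, one_mul] at this
  refine ⟨Matrix.of fun i j => G i.succ j.succ - G i.succ 0 * ((G 0 0)⁻¹ * G 0 j.succ), ?_, ?_⟩
  · intro i j
    simp only [Matrix.of_apply]
    rw [mul_sub, ← mul_assoc _ (G i.succ 0)]
    exact sub_mem (hG _ _) (mul_mem (hG _ _) (hq _ _))
  · have hblock : (Matrix.fromBlocks (Matrix.of fun _ _ : Unit => G 0 0)
        (Matrix.of fun _ j => G 0 (Fin.succ j)) (Matrix.of fun i _ => G (Fin.succ i) 0)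
        (Matrix.of fun i j => G (Fin.succ i) (Fin.succ j))).submatrix
        (unitSumEquiv p) (unitSumEquiv m) = G := by
      ext i j
      refine Fin.cases ?_ (fun i => ?_) i <;> refine Fin.cases ?_ (fun j => ?_) j <;>
        simp [unitSumEquiv]
    set T : Matrix (Fin p) (Fin m) (RatFunc F) :=
      Matrix.of fun i j => G i.succ j.succ - G i.succ 0 * ((G 0 0)⁻¹ * G 0 j.succ) with hT
    clear_value T
    suffices h : EquivalentAt _ _ a from hblock ▸ EquivalentAt.reindex h _ _
    subst hT
    refine ⟨_, _, hL, hU.mul hV, ?_⟩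
    rw [← Matrix.mul_assoc, Matrix.fromBlocks_multiply, Matrix.fromBlocks_multiply,
      Matrix.fromBlocks_multiply]
    congr 1
    · ext i j
      simp [Matrix.mul_apply, h0, hu0]
    · ext i j
      simp [Matrix.mul_apply, y, hg0]
    · ext i j
      simp [Matrix.mul_apply, x]
      left
      field_simp
      ring
    · ext i j
      simp [Matrix.mul_apply, x, y]
      field_simp
      ring

theorem exists_localDiag_aux (a : F) : ∀ (p m : ℕ) (G : Matrix (Fin p) (Fin m) (RatFunc F))
    (l : ℤ), (∀ i j, localParam a ^ (-l) * G i j ∈ localRing a) →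
    ∃ (r : ℕ) (ν : Fin r → ℤ), r ≤ p ∧ r ≤ m ∧ Monotone ν ∧ (∀ i, l ≤ ν i) ∧
      EquivalentAt G (localDiag p m ν a) a := by
  intro p
  induction p with
  | zero =>
    intro m G l _
    exact ⟨0, Fin.elim0, le_rfl, Nat.zero_le _, fun i => i.elim0, fun i => i.elim0,
      1, 1, isRegularAt_one a, isRegularAt_one a, by ext i; exact i.elim0⟩
  | succ p ih =>
    intro m G l hl
    by_cases hG : G = 0
    · refine ⟨0, Fin.elim0, Nat.zero_le _, Nat.zero_le _, fun i => i.elim0, fun i => i.elim0,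
        1, 1, isRegularAt_one a, isRegularAt_one a, ?_⟩
      ext i j
      simp [hG, localDiag]
    cases m with
    | zero => exact absurd (by ext i j; exact j.elim0) hG
    | succ m =>
      have hex : ∀ f : RatFunc F, ∃ (k : ℤ) (u : RatFunc F), f ≠ 0 → (u ≠ 0 ∧ u ∈ localRing a ∧
          u⁻¹ ∈ localRing a ∧ f = localParam a ^ k * u) := by
        intro f
        by_cases hf : f = 0
        · exact ⟨0, 0, fun h => absurd hf h⟩
        · obtain ⟨k, u, h⟩ := exists_eq_zpow_mul hf a
          exact ⟨k, u, fun _ => h⟩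
      choose o u hou using hex
      classical
      have hne : (Finset.univ.filter fun ij : Fin (p + 1) × Fin (m + 1) =>
          G ij.1 ij.2 ≠ 0).Nonempty := by
        by_contra hcon
        rw [Finset.not_nonempty_iff_eq_empty, Finset.filter_eq_empty_iff] at hcon
        apply hG
        ext i j
        have := hcon (Finset.mem_univ (i, j))
        simpa using this
      obtain ⟨⟨i₀, j₀⟩, hmem, hmin⟩ := Finset.exists_min_image _
        (fun ij : Fin (p + 1) × Fin (m + 1) => o (G ij.1 ij.2)) hne
      have h00 : G i₀ j₀ ≠ 0 := by simpa using hmem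
      set k := o (G i₀ j₀) with hk
      obtain ⟨u₀, hu0, hu1, hu2, huf⟩ : ∃ u₀, u₀ ≠ 0 ∧ u₀ ∈ localRing a ∧ u₀⁻¹ ∈ localRing a ∧
          G i₀ j₀ = localParam a ^ k * u₀ := ⟨_, hou _ h00⟩
      have hord : ∀ i j, localParam a ^ (-k) * G i j ∈ localRing a := by
        intro i j
        by_cases hij : G i j = 0
        · rw [hij, mul_zero]; exact zero_mem _
        · obtain ⟨_, hv1, _, hvf⟩ := hou _ hij
          have hle : k ≤ o (G i j) := hmin (i, j) (Finset.mem_filter.2 ⟨Finset.mem_univ _, hij⟩)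
          rw [hvf, ← mul_assoc, ← zpow_add₀ (localParam_ne_zero a)]
          exact mul_mem (localParam_zpow_mem a (by omega)) hv1
      have hlk : l ≤ k := by
        have h1 := mul_mem (hl i₀ j₀) hu2
        rw [huf, mul_assoc, mul_assoc, mul_inv_cancel₀ hu0, mul_one,
          ← zpow_add₀ (localParam_ne_zero a)] at h1
        have := nonneg_of_localParam_zpow_mem a h1
        omega
      set G' := G.submatrix (Equiv.swap 0 i₀) (Equiv.swap 0 j₀)
      obtain ⟨S, hS, hGS⟩ := equivalentAt_pivot G' a k u₀ hu0 hu2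
        (by simpa [G'] using huf) (fun i j => hord _ _)
      obtain ⟨r, ν, hrp, hrm, hmono, hνk, hSν⟩ := ih m S k hS
      refine ⟨r + 1, Fin.cons k ν, by omega, by omega, ?_, ?_, ?_⟩
      · intro i j hij
        induction i using Fin.cases with
        | zero =>
          induction j using Fin.cases with
          | zero => exact le_rfl
          | succ j => simpa using hνk j
        | succ i =>
          induction j using Fin.cases with
          | zero => exact absurd hij (by simp)
          | succ j => simpa using hmono (Fin.succ_le_succ_iff.1 hij)
      · intro i
        induction i using Fin.cases with
        | zero => exact hlk
        | succ i => exact hlk.trans (by simpa using hνk i)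
      · refine ((equivalentAt_perm G _ _ a).trans hGS).trans ?_
        rw [localDiag_cons]
        exact (hSν.fromBlocks _).reindex _ _

theorem rank_localDiag {p m r : ℕ} (hp : r ≤ p) (hm : r ≤ m) (ν : Fin r → ℤ) (a : F) :
    (localDiag p m ν a).rank = r := by
  apply le_antisymm
  · set E : Matrix (Fin p) (Fin r) (RatFunc F) :=
      Matrix.of fun i k => if i.val = k.val then localParam a ^ ν k else 0
    set E' : Matrix (Fin r) (Fin m) (RatFunc F) :=
      Matrix.of fun k j => if k.val = j.val then 1 else 0
    have : localDiag p m ν a = E * E' := by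
      ext i j
      simp only [localDiag, Matrix.of_apply, Matrix.mul_apply, E, E']
      split_ifs with h
      · rw [Finset.sum_eq_single ⟨i.val, h.2⟩]
        · simp [h.1]
        · intro b _ hb
          rw [if_neg, zero_mul]
          intro hb'
          exact hb (Fin.ext hb'.symm)
        · simp
      · symm
        apply Finset.sum_eq_zero
        intro b _
        by_cases h1 : i.val = b.val
        · rw [if_neg (c := b.val = j.val), mul_zero]
          intro h2
          exact h ⟨h1.trans h2, h1 ▸ b.2⟩
        · rw [if_neg h1, zero_mul]
    rw [this]
    exact (Matrix.rank_mul_le_left _ _).trans (by simpa using Matrix.rank_le_width E)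
  · have h1 : (localDiag p m ν a).submatrix (Fin.castLE hp) (Fin.castLE hm) =
        Matrix.diagonal fun i => localParam a ^ ν i := by
      ext i j
      simp only [localDiag, Matrix.submatrix_apply, Matrix.of_apply, Fin.val_castLE,
        Matrix.diagonal_apply]
      by_cases h : i = j
      · subst h; simp
      · rw [dif_neg, if_neg h]
        rintro ⟨h', _⟩
        exact h (Fin.ext h')
    have h2 := Matrix.rank_submatrix_le (localDiag p m ν a) (Fin.castLE hp) (Fin.castLE hm)
    rw [h1, Matrix.rank_of_isUnit] at h2
    · simpa using h2
    · rw [Matrix.isUnit_iff_isUnit_det, Matrix.det_diagonal, isUnit_iff_ne_zero,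
        Finset.prod_ne_zero_iff]
      exact fun i _ => zpow_ne_zero _ (localParam_ne_zero a)

/-- Every rational matrix has a local Smith–McMillan form at every finite point. -/
theorem exists_isInvariantOrders {p m : ℕ} (G : Matrix (Fin p) (Fin m) (RatFunc F)) (a : F) :
    ∃ ν : Fin G.rank → ℤ, IsInvariantOrders G a ν := by
  have hb : ∃ l : ℤ, ∀ i j, localParam a ^ (-l) * G i j ∈ localRing a := by
    have hex : ∀ ij : Fin p × Fin m, ∃ k : ℤ, ∀ l ≤ k,
        localParam a ^ (-l) * G ij.1 ij.2 ∈ localRing a := by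
      intro ij
      by_cases h : G ij.1 ij.2 = 0
      · exact ⟨0, fun l _ => by rw [h, mul_zero]; exact zero_mem _⟩
      · obtain ⟨k, u, _, hu, _, hf⟩ := exists_eq_zpow_mul h a
        refine ⟨k, fun l hl => ?_⟩
        rw [hf, ← mul_assoc, ← zpow_add₀ (localParam_ne_zero a)]
        exact mul_mem (localParam_zpow_mem a (by omega)) hu
    choose k hk using hex
    obtain ⟨l, hl⟩ := (Set.finite_range k).bddBelow
    exact ⟨l, fun i j => hk (i, j) l (hl ⟨_, rfl⟩)⟩
  obtain ⟨l, hl⟩ := hb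
  obtain ⟨r, ν, hrp, hrm, hmono, -, hν⟩ := exists_localDiag_aux a p m G l hl
  have hr : G.rank = r := by rw [← hν.rank_eq, rank_localDiag hrp hrm]
  subst hr
  exact ⟨ν, hmono, hν⟩

/-! ### Invariant orders and elementary divisors -/

/-- The invariant orders `ν₁ ≤ ⋯ ≤ νᵣ` of a rational matrix at `a`: the exponents of its local
Smith–McMillan form. -/
def invariantOrders {p m : ℕ} (G : Matrix (Fin p) (Fin m) (RatFunc F)) (a : F) :
    Fin G.rank → ℤ :=
  (exists_isInvariantOrders G a).choose

theorem isInvariantOrders_invariantOrders {p m : ℕ} (G : Matrix (Fin p) (Fin m) (RatFunc F))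
    (a : F) : IsInvariantOrders G a (invariantOrders G a) :=
  (exists_isInvariantOrders G a).choose_spec

/-- The pole elementary divisors `(λ - a) ^ (-νᵢ)`, `νᵢ < 0`, with repetitions. -/
def poleElementaryDivisors {p m : ℕ} (G : Matrix (Fin p) (Fin m) (RatFunc F)) (a : F) :
    Multiset F[X] :=
  (Finset.univ.filter fun i => invariantOrders G a i < 0).val.map
    fun i => (X - C a) ^ (-invariantOrders G a i).toNat

/-- The zero elementary divisors `(λ - a) ^ νᵢ`, `νᵢ > 0`, with repetitions. -/
def zeroElementaryDivisors {p m : ℕ} (G : Matrix (Fin p) (Fin m) (RatFunc F)) (a : F) :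
    Multiset F[X] :=
  (Finset.univ.filter fun i => 0 < invariantOrders G a i).val.map
    fun i => (X - C a) ^ (invariantOrders G a i).toNat

/-- A polynomial matrix as a rational matrix. -/
def ofPolynomial {ι κ : Type*} (M : Matrix ι κ F[X]) : Matrix ι κ (RatFunc F) :=
  M.map (algebraMap F[X] (RatFunc F))

/-- The elementary divisors `(λ - a) ^ νᵢ`, `νᵢ ≠ 0`, with repetitions, of a polynomial matrix
(whose invariant orders are all nonnegative). -/
def elementaryDivisors {p m : ℕ} (M : Matrix (Fin p) (Fin m) F[X]) (a : F) : Multiset F[X] :=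
  (Finset.univ.filter fun i => invariantOrders (ofPolynomial M) a i ≠ 0).val.map
    fun i => (X - C a) ^ (invariantOrders (ofPolynomial M) a i).toNat

end Local

/-! ### Polynomial system matrices -/

/-- The data of a polynomial system matrix `[A B; -C D]` with nonsingular `n × n` state
matrix `A`; for `n = 0` the blocks `A`, `B`, `C` are empty. -/
structure PolynomialSystemMatrix (F : Type*) [Field F] (n p m : ℕ) where
  A : Matrix (Fin n) (Fin n) F[X]
  B : Matrix (Fin n) (Fin m) F[X]
  C : Matrix (Fin p) (Fin n) F[X]
  D : Matrix (Fin p) (Fin m) F[X]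
  det_A_ne_zero : A.det ≠ 0

namespace PolynomialSystemMatrix

variable {F : Type*} [Field F] {n p m : ℕ}

/-- The `(n + p) × (n + m)` polynomial matrix `[A B; -C D]`. -/
def toMatrix (P : PolynomialSystemMatrix F n p m) : Matrix (Fin (n + p)) (Fin (n + m)) F[X] :=
  Matrix.reindex finSumFinEquiv finSumFinEquiv (Matrix.fromBlocks P.A P.B (-P.C) P.D)

/-- The transfer function matrix `D + C A⁻¹ B`. -/
def transferFunction (P : PolynomialSystemMatrix F n p m) : Matrix (Fin p) (Fin m) (RatFunc F) :=
  ofPolynomial P.D + ofPolynomial P.C * (ofPolynomial P.A)⁻¹ * ofPolynomial P.B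

/-- Minimality at `a`: `rank [A(a); C(a)] = rank [A(a) B(a)] = n`. For `n = 0` this holds
at every point. -/
def IsMinimalAt (P : PolynomialSystemMatrix F n p m) (a : F) : Prop :=
  (Matrix.fromRows (P.A.map (Polynomial.eval a)) (P.C.map (Polynomial.eval a))).rank = n ∧
  (Matrix.fromCols (P.A.map (Polynomial.eval a)) (P.B.map (Polynomial.eval a))).rank = n

end PolynomialSystemMatrix

end RationalMatrix

end

open Polynomial
open scoped Matrix

noncomputable section

namespace RationalMatrix

/-! ### Uniqueness of the exponents of a finite product of cyclic torsion modules -/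

section Uniqueness

/-! Let R be the ring of rational functions defined at λ₀, with uniformizer t = λ - λ₀, and let K =
F(λ). The pole module R^m / {v | Gv ∈ R^p} and the zero module (R^p ∩ G K^m) / (R^p ∩ G R^m) do not
change, up to isomorphism, when G is multiplied by invertible matrices over R. On the local
Smith–McMillan form they are the products of the R/(t^max(-νᵢ,0)) and of the R/(t^max(νᵢ,0)). The
lengths of t^k M recover the nonzero exponents of such a product M, so pole and zero elementary
divisors can be compared through module isomorphisms.

Minimality at λ₀ lifts to Bézout identities AX + BY = 1 and UA + VC = 1 over R. Introduce the state
x = A⁻¹Bv, so that Gv = Dv + Cx. If v and Gv are integral, then Ax and Cx are integral, hence so is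
x = U(Ax) + V(Cx). With this, v ↦ Bv induces an isomorphism from the pole module of G to the zero
module of A (`poleModule_equiv_zeroModule`), and y ↦ (0, y) one from the zero module of G to that of
P (`zeroModule_equiv_zeroModule_fromBlocks`). The left identity gives surjectivity, the right one
the kernel. Since A and P are polynomial, all their orders are nonnegative and their elementary
divisors are their zero elementary divisors. -/

theorem sum_tsub_second_difference {ι : Type*} [Fintype ι] (c : ι → ℕ) {x : ℕ} (hx : x ≠ 0) :
    ∑ i, (c i - (x - 1)) + ∑ i, (c i - (x + 1)) =
      2 * ∑ i, (c i - x) + (Finset.univ.filter fun i => x = c i).card := by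
  rw [Finset.card_filter, Finset.mul_sum, ← Finset.sum_add_distrib, ← Finset.sum_add_distrib]
  refine Finset.sum_congr rfl fun i _ => ?_
  -- Truncated subtraction k ↦ c i - k is piecewise linear with a single kink, at c i. At x = 0 the
  -- identity would fail, because x - 1 truncates to 0.
  split_ifs <;> omega

/-- The multiplicity of a value x ≠ 0 is the second difference at x of k ↦ ∑ (c i - k), so these
sums determine the nonzero part of the family. Zero exponents are invisible to them, which is why
the two index types may differ. -/
theorem filter_ne_zero_map_eq_of_sum_tsub_eq {ι κ α : Type*} [Fintype ι] [Fintype κ]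
    {c : ι → ℕ} {d : κ → ℕ} (h : ∀ k, ∑ i, (c i - k) = ∑ j, (d j - k)) (f : ℕ → α) :
    (Finset.univ.filter fun i => c i ≠ 0).val.map (fun i => f (c i)) =
      (Finset.univ.filter fun j => d j ≠ 0).val.map (fun j => f (d j)) := by
  have key : (Finset.univ.val.map c).filter (· ≠ 0) = (Finset.univ.val.map d).filter (· ≠ 0) := by
    ext x
    rw [Multiset.count_filter, Multiset.count_filter]
    split_ifs with hx
    · rw [Multiset.count_map, Multiset.count_map]
      have h1 := sum_tsub_second_difference c hx
      have h2 := sum_tsub_second_difference d hx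
      rw [h, h, h] at h1
      exact (Nat.add_left_cancel (h1.symm.trans h2))
    · rfl
  rw [Multiset.filter_map, Multiset.filter_map] at key
  have := congrArg (Multiset.map f) key
  rw [Multiset.map_map, Multiset.map_map] at this
  exact this

variable {R : Type*} [CommRing R]

/-- The product of the cyclic modules `R / (t ^ cᵢ)`. -/
abbrev CyclicProduct {ι : Type*} (t : R) (c : ι → ℕ) : Type _ :=
  ∀ i, R ⧸ Ideal.span {t ^ c i}

/-- The canonical projection onto a product of cyclic modules. -/
def cyclicProductMk {ι : Type*} (t : R) (c : ι → ℕ) : (ι → R) →ₗ[R] CyclicProduct t c :=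
  LinearMap.pi fun i => (Ideal.span {t ^ c i}).mkQ ∘ₗ LinearMap.proj i

theorem cyclicProductMk_surjective {ι : Type*} (t : R) (c : ι → ℕ) :
    Function.Surjective (cyclicProductMk t c) := by
  intro y
  choose x hx using fun i => Submodule.mkQ_surjective _ (y i)
  exact ⟨x, funext hx⟩

theorem cyclicProductMk_eq_zero_iff {ι : Type*} {t : R} {c : ι → ℕ} {x : ι → R} :
    cyclicProductMk t c x = 0 ↔ ∀ i, t ^ c i ∣ x i := by
  simp only [funext_iff, ← Ideal.mem_span_singleton]
  exact forall_congr' fun i => Submodule.Quotient.mk_eq_zero _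

/-- R/(t) is simple because (t) is maximal, and the order function is additive on powers of a
non-zero-divisor, so R/(t^c) has length c. -/
theorem length_cyclicProduct [IsDomain R] {ι : Type*} [Fintype ι] {t : R} (ht : t ≠ 0)
    (hmax : (Ideal.span {t}).IsMaximal) (c : ι → ℕ) :
    Module.length R (CyclicProduct t c) = (∑ i, c i : ℕ) := by
  have h1 : Ring.ord R t = 1 := by
    rw [Ring.ord, Module.length_eq_one_iff]
    exact isSimpleModule_iff_isCoatom.2 hmax.out
  rw [Module.length_pi_of_fintype]
  push_cast
  refine Finset.sum_congr rfl fun i _ => ?_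
  have := Ring.ord_pow (mem_nonZeroDivisors_of_ne_zero ht) (c i)
  rw [h1] at this
  simpa [Ring.ord] using this

/-- t^k · ∏ R/(t^cᵢ) is isomorphic to ∏ R/(t^(cᵢ - k)): both are quotients of R^ι by the same
kernel, since t^c ∣ t^k x iff t^(c - k) ∣ x. Truncation covers k ≥ c, where both conditions are
vacuous. -/
theorem length_range_lsmul_cyclicProduct [IsDomain R] {ι : Type*} [Fintype ι] {t : R} (ht : t ≠ 0)
    (hmax : (Ideal.span {t}).IsMaximal) (c : ι → ℕ) (k : ℕ) :
    Module.length R (LinearMap.range (LinearMap.lsmul R (CyclicProduct t c) (t ^ k))) =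
      (∑ i, (c i - k) : ℕ) := by
  rw [← length_cyclicProduct ht hmax]
  set g := LinearMap.lsmul R (CyclicProduct t c) (t ^ k) ∘ₗ cyclicProductMk t c
  have hrange : LinearMap.range g = LinearMap.range (LinearMap.lsmul R _ (t ^ k)) :=
    LinearMap.range_comp_of_range_eq_top _
      (LinearMap.range_eq_top.2 (cyclicProductMk_surjective t c))
  have hker : LinearMap.ker g = LinearMap.ker (cyclicProductMk t fun i => c i - k) := by
    ext x
    have hgx : g x = cyclicProductMk t c (t ^ k • x) := by
      simp [g]
    rw [LinearMap.mem_ker, LinearMap.mem_ker, hgx, cyclicProductMk_eq_zero_iff,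
      cyclicProductMk_eq_zero_iff]
    refine forall_congr' fun i => ?_
    rw [Pi.smul_apply, smul_eq_mul]
    rcases le_total k (c i) with hk | hk
    · obtain ⟨d, hd⟩ := Nat.exists_eq_add_of_le hk
      rw [hd, Nat.add_sub_cancel_left, pow_add]
      exact mul_dvd_mul_iff_left (pow_ne_zero _ ht)
    · rw [Nat.sub_eq_zero_of_le hk, pow_zero]
      exact iff_of_true ((pow_dvd_pow t hk).mul_right _) (one_dvd _)
  rw [← hrange, ← g.quotKerEquivRange.length_eq, hker]
  exact (LinearMap.quotKerEquivOfSurjective _ (cyclicProductMk_surjective _ _)).length_eq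

theorem sum_tsub_eq_of_cyclicProduct_equiv [IsDomain R] {ι κ : Type*} [Fintype ι] [Fintype κ]
    {t : R} (ht : t ≠ 0) (hmax : (Ideal.span {t}).IsMaximal) {c : ι → ℕ} {d : κ → ℕ}
    (e : CyclicProduct t c ≃ₗ[R] CyclicProduct t d) (k : ℕ) :
    ∑ i, (c i - k) = ∑ j, (d j - k) := by
  have h : (LinearMap.range (LinearMap.lsmul R (CyclicProduct t c) (t ^ k))).map e.toLinearMap =
      LinearMap.range (LinearMap.lsmul R (CyclicProduct t d) (t ^ k)) := by
    ext y
    constructor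
    · rintro ⟨_, ⟨x, rfl⟩, rfl⟩
      exact ⟨e x, by simp⟩
    · rintro ⟨x, rfl⟩
      exact ⟨_, ⟨e.symm x, rfl⟩, by simp⟩
  have h1 := (e.submoduleMap
    (LinearMap.range (LinearMap.lsmul R (CyclicProduct t c) (t ^ k)))).length_eq
  rw [length_range_lsmul_cyclicProduct ht hmax] at h1
  erw [h] at h1
  rw [length_range_lsmul_cyclicProduct ht hmax] at h1
  exact_mod_cast h1

end Uniqueness

/-! ### Pole and zero modules of a matrix over a ring extension -/

section Modules

variable {R : Type*} [CommRing R]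

/-- The quotient `N / (N ∩ L)`. -/
abbrev Subquotient {M : Type*} [AddCommGroup M] [Module R M] (N L : Submodule R M) : Type _ :=
  N ⧸ L.submoduleOf N

theorem subquotient_equiv_of_ker {M Q : Type*} [AddCommGroup M] [Module R M] [AddCommGroup Q]
    [Module R Q] {N L : Submodule R M} (g : M →ₗ[R] Q) (hsurj : ∀ q, ∃ y ∈ N, g y = q)
    (hker : ∀ y ∈ N, g y = 0 ↔ y ∈ L) : Nonempty (Subquotient N L ≃ₗ[R] Q) := by
  have h1 : L.submoduleOf N = LinearMap.ker (g ∘ₗ N.subtype) := by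
    ext y
    exact (hker y y.2).symm
  have h2 : Function.Surjective (g ∘ₗ N.subtype) := fun q => by
    obtain ⟨y, hy, rfl⟩ := hsurj q
    exact ⟨⟨y, hy⟩, rfl⟩
  exact ⟨(Submodule.quotEquivOfEq _ _ h1).trans (LinearMap.quotKerEquivOfSurjective _ h2)⟩

/-- First isomorphism theorem in the form in which every comparison of pole and zero modules is
made: g need only hit N' modulo L', and the kernel is tested only on N. -/
theorem subquotient_equiv {M M' : Type*} [AddCommGroup M] [Module R M] [AddCommGroup M']
    [Module R M'] {N L : Submodule R M} {N' L' : Submodule R M'} (g : M →ₗ[R] M')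
    (hmap : ∀ y ∈ N, g y ∈ N') (hsurj : ∀ z ∈ N', ∃ y ∈ N, g y - z ∈ L')
    (hker : ∀ y ∈ N, g y ∈ L' ↔ y ∈ L) :
    Nonempty (Subquotient N L ≃ₗ[R] Subquotient N' L') := by
  set f := (L'.submoduleOf N').mkQ ∘ₗ g.restrict hmap
  have h1 : L.submoduleOf N = LinearMap.ker f := by
    ext y
    rw [LinearMap.mem_ker]
    exact (hker y y.2).symm.trans (Submodule.Quotient.mk_eq_zero (L'.submoduleOf N')
      (x := g.restrict hmap y)).symm
  have h2 : Function.Surjective f := fun q => by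
    obtain ⟨⟨z, hz⟩, rfl⟩ := Submodule.mkQ_surjective _ q
    obtain ⟨y, hy, h⟩ := hsurj z hz
    exact ⟨⟨y, hy⟩, (Submodule.Quotient.eq _).2 h⟩
  exact ⟨(Submodule.quotEquivOfEq _ _ h1).trans (LinearMap.quotKerEquivOfSurjective _ h2)⟩

variable {K : Type*} [Field K] [Algebra R K] {ι κ : Type*} [Fintype κ]

variable (R K) in
/-- The inclusion of `R ^ ι` into `K ^ ι`. -/
def vecMap (ι : Type*) : (ι → R) →ₗ[R] (ι → K) := (Algebra.linearMap R K).compLeft ι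

theorem vecMap_apply (v : ι → R) (i : ι) : vecMap R K ι v i = algebraMap R K (v i) := rfl

theorem map_mulVec_vecMap (M : Matrix ι κ R) (v : κ → R) :
    M.map (algebraMap R K) *ᵥ vecMap R K κ v = vecMap R K ι (M *ᵥ v) :=
  funext fun i => (RingHom.map_mulVec (algebraMap R K) M v i).symm

variable (R) in
/-- `R ^ ι ∩ G K ^ κ`. -/
def saturatedImage (G : Matrix ι κ K) : Submodule R (ι → R) :=
  (LinearMap.range (G.mulVecLin.restrictScalars R)).comap (vecMap R K ι)

variable (R) in
/-- `R ^ ι ∩ G R ^ κ`. -/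
def integralImage (G : Matrix ι κ K) : Submodule R (ι → R) :=
  (LinearMap.range (G.mulVecLin.restrictScalars R ∘ₗ vecMap R K κ)).comap (vecMap R K ι)

variable (R) in
/-- The vectors of `R ^ κ` that `G` maps into `R ^ ι`. -/
def integralDomain (G : Matrix ι κ K) : Submodule R (κ → R) :=
  (LinearMap.range (vecMap R K ι)).comap (G.mulVecLin.restrictScalars R ∘ₗ vecMap R K κ)

theorem mem_integralImage {G : Matrix ι κ K} {y : ι → R} :
    y ∈ integralImage R G ↔ ∃ v, G *ᵥ vecMap R K κ v = vecMap R K ι y := Iff.rfl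

theorem mem_integralDomain {G : Matrix ι κ K} {v : κ → R} :
    v ∈ integralDomain R G ↔ ∃ y, vecMap R K ι y = G *ᵥ vecMap R K κ v := Iff.rfl

variable (R) in
/-- The zero module `(R ^ ι ∩ G K ^ κ) / (R ^ ι ∩ G R ^ κ)`. -/
abbrev ZeroModule (G : Matrix ι κ K) : Type _ :=
  Subquotient (saturatedImage R G) (integralImage R G)

variable (R) in
/-- The pole module `R ^ κ / {v | G v ∈ R ^ ι}`. -/
abbrev PoleModule (G : Matrix ι κ K) : Type _ :=
  Subquotient (⊤ : Submodule R (κ → R)) (integralDomain R G)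

/-- Needed because the block matrix is indexed by sum types, whereas elementary divisors are defined
for matrices indexed by `Fin`. -/
theorem zeroModule_submatrix_equiv {ι' κ' : Type*} [Fintype κ'] (G : Matrix ι κ K)
    (e : ι' ≃ ι) (f : κ' ≃ κ) :
    Nonempty (ZeroModule R G ≃ₗ[R] ZeroModule R (G.submatrix e f)) := by
  have hcomp : ∀ {v : κ → K} {y : ι → R}, G *ᵥ v = vecMap R K ι y ↔
      G.submatrix e f *ᵥ (v ∘ f) = vecMap R K ι' (y ∘ e) := by
    intro v y
    rw [Matrix.submatrix_mulVec_equiv, Function.comp_assoc, Equiv.self_comp_symm,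
      Function.comp_id]
    exact ⟨fun h => by rw [h]; rfl, fun h => e.surjective.injective_comp_right h⟩
  refine subquotient_equiv (LinearMap.funLeft R R e) ?_ ?_ ?_
  · rintro y ⟨v, hv⟩
    exact ⟨v ∘ f, hcomp.1 hv⟩
  · rintro z ⟨v, hv⟩
    refine ⟨z ∘ e.symm, ⟨v ∘ f.symm, hcomp.2 ?_⟩, ?_⟩
    · rw [Function.comp_assoc, Function.comp_assoc, Equiv.symm_comp_self, Equiv.symm_comp_self]
      exact hv
    · have : LinearMap.funLeft R R e (z ∘ e.symm) = z := by
        ext i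
        simp [LinearMap.funLeft_apply]
      rw [this, sub_self]
      exact zero_mem _
  · intro y _
    constructor
    · rintro ⟨v, hv⟩
      refine ⟨v ∘ f.symm, hcomp.2 ?_⟩
      have : vecMap R K κ (v ∘ f.symm) ∘ f = vecMap R K κ' v := by
        ext i
        simp [vecMap_apply]
      rw [this]
      exact hv
    · rintro ⟨v, hv⟩
      exact ⟨v ∘ f, hcomp.1 hv⟩

/-! ### The system [A B; -C D] over R and its transfer matrix over K -/

section System

variable {ν : Type*} [Fintype ν] [DecidableEq ν]
  {A : Matrix ν ν R} {B : Matrix ν κ R} {C : Matrix ι ν R} {D : Matrix ι κ R} {G : Matrix ι κ K}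

/-- Replaces A⁻¹ by a state x with Ax = Bv, whose integrality can then be studied on its own. -/
theorem mulVec_eq_of_state_eq (hA : IsUnit (A.map (algebraMap R K)).det)
    (hG : G = D.map (algebraMap R K) +
      C.map (algebraMap R K) * (A.map (algebraMap R K))⁻¹ * B.map (algebraMap R K))
    {x : ν → K} {v : κ → K}
    (hx : A.map (algebraMap R K) *ᵥ x = B.map (algebraMap R K) *ᵥ v) :
    G *ᵥ v = D.map (algebraMap R K) *ᵥ v + C.map (algebraMap R K) *ᵥ x := by
  have : (A.map (algebraMap R K))⁻¹ *ᵥ (B.map (algebraMap R K) *ᵥ v) = x := by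
    rw [← hx, Matrix.mulVec_mulVec, Matrix.nonsing_inv_mul _ hA, Matrix.one_mulVec]
  rw [hG, Matrix.add_mulVec, ← Matrix.mulVec_mulVec, ← Matrix.mulVec_mulVec, this]

theorem exists_state_eq (hA : IsUnit (A.map (algebraMap R K)).det) (b : ν → K) :
    ∃ x, A.map (algebraMap R K) *ᵥ x = b :=
  ⟨(A.map (algebraMap R K))⁻¹ *ᵥ b, by
    rw [Matrix.mulVec_mulVec, Matrix.mul_nonsing_inv _ hA, Matrix.one_mulVec]⟩

/-- If `A` and `C` are right coprime, a state with integral input and output is integral. -/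
theorem exists_vecMap_eq_state [Fintype ι]
    {U : Matrix ν ν R} {V : Matrix ν ι R} (hUV : U * A + V * C = 1)
    {x : ν → K} {b : ν → R} {y : ι → R}
    (hb : A.map (algebraMap R K) *ᵥ x = vecMap R K ν b)
    (hy : C.map (algebraMap R K) *ᵥ x = vecMap R K ι y) : ∃ x', vecMap R K ν x' = x := by
  -- The Bézout identity applied to x reads x = U(Ax) + V(Cx).
  refine ⟨U *ᵥ b + V *ᵥ y, ?_⟩
  rw [map_add, ← map_mulVec_vecMap, ← map_mulVec_vecMap, ← hb, ← hy, Matrix.mulVec_mulVec,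
    Matrix.mulVec_mulVec, ← Matrix.add_mulVec, ← Matrix.map_mul, ← Matrix.map_mul,
    ← Matrix.map_add _ (map_add _), hUV, Matrix.map_one _ (map_zero _) (map_one _),
    Matrix.one_mulVec]

/-- The state has integral Ax = Bv and integral Cx = Gv - Dv, so right coprimeness applies. -/
theorem exists_vecMap_eq_of_mem_integralDomain [Fintype ι]
    (hA : IsUnit (A.map (algebraMap R K)).det)
    (hG : G = D.map (algebraMap R K) +
      C.map (algebraMap R K) * (A.map (algebraMap R K))⁻¹ * B.map (algebraMap R K))
    {U : Matrix ν ν R} {V : Matrix ν ι R} (hUV : U * A + V * C = 1)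
    {v : κ → R} (hv : v ∈ integralDomain R G) {x : ν → K}
    (hx : A.map (algebraMap R K) *ᵥ x = B.map (algebraMap R K) *ᵥ vecMap R K κ v) :
    ∃ x', vecMap R K ν x' = x := by
  obtain ⟨y, hy⟩ := hv
  replace hy : vecMap R K ι y = G *ᵥ vecMap R K κ v := hy
  rw [mulVec_eq_of_state_eq hA hG hx, map_mulVec_vecMap] at hy
  refine exists_vecMap_eq_state hUV (hx.trans (map_mulVec_vecMap B v)) (y := y - D *ᵥ v) ?_
  rw [map_sub, hy, add_sub_cancel_left]

/-- The isomorphism is induced by v ↦ Bv. As A is invertible over K, its saturated image is all of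
R^ν, so the target is R^ν / A R^ν. The vector Bv lies in A R^ν exactly when the state A⁻¹Bv is
integral, which right coprimeness makes equivalent to integrality of Gv. -/
theorem poleModule_equiv_zeroModule [Fintype ι]
    (hA : IsUnit (A.map (algebraMap R K)).det)
    (hG : G = D.map (algebraMap R K) +
      C.map (algebraMap R K) * (A.map (algebraMap R K))⁻¹ * B.map (algebraMap R K))
    {X : Matrix ν ν R} {Y : Matrix κ ν R} (hXY : A * X + B * Y = 1)
    {U : Matrix ν ν R} {V : Matrix ν ι R} (hUV : U * A + V * C = 1) :
    Nonempty (PoleModule R G ≃ₗ[R] ZeroModule R (A.map (algebraMap R K))) := by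
  refine subquotient_equiv B.mulVecLin (fun v _ => exists_state_eq hA _) ?_ ?_
  · intro z _
    -- From AX + BY = 1: B(Yz) - z = A(X(-z)).
    refine ⟨Y *ᵥ z, trivial, X *ᵥ -z, ?_⟩
    have h : A *ᵥ (X *ᵥ z) + B *ᵥ (Y *ᵥ z) = z := by
      rw [Matrix.mulVec_mulVec, Matrix.mulVec_mulVec, ← Matrix.add_mulVec, hXY, Matrix.one_mulVec]
    change A.map (algebraMap R K) *ᵥ vecMap R K ν (X *ᵥ -z) = _
    rw [map_mulVec_vecMap, Matrix.mulVec_neg, Matrix.mulVec_neg, Matrix.mulVecLin_apply]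
    congr 1
    nth_rw 3 [← h]
    abel
  · intro v _
    constructor
    · rintro ⟨x, hx⟩
      replace hx : A.map (algebraMap R K) *ᵥ vecMap R K ν x = vecMap R K ν (B *ᵥ v) := hx
      rw [← map_mulVec_vecMap] at hx
      refine ⟨D *ᵥ v + C *ᵥ x, ?_⟩
      change _ = G *ᵥ vecMap R K κ v
      rw [mulVec_eq_of_state_eq hA hG hx, map_add, map_mulVec_vecMap, map_mulVec_vecMap]
    · intro hv
      obtain ⟨x, hx⟩ := exists_state_eq hA (B.map (algebraMap R K) *ᵥ vecMap R K κ v)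
      obtain ⟨x, rfl⟩ := exists_vecMap_eq_of_mem_integralDomain hA hG hUV hv hx
      exact ⟨x, hx.trans (map_mulVec_vecMap B v)⟩

/-- Because of the sign in -C, the state is minus the first component of w: the top row says Ax =
Bv, and the bottom row then says Dv + Cx = y. -/
theorem fromBlocks_mulVec_eq_iff (hA : IsUnit (A.map (algebraMap R K)).det)
    (hG : G = D.map (algebraMap R K) +
      C.map (algebraMap R K) * (A.map (algebraMap R K))⁻¹ * B.map (algebraMap R K))
    {w : ν ⊕ κ → K} {y : ι → R} :
    (Matrix.fromBlocks A B (-C) D).map (algebraMap R K) *ᵥ w =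
        vecMap R K (ν ⊕ ι) (Sum.elim 0 y) ↔
      A.map (algebraMap R K) *ᵥ (-(w ∘ Sum.inl)) = B.map (algebraMap R K) *ᵥ (w ∘ Sum.inr) ∧
        G *ᵥ (w ∘ Sum.inr) = vecMap R K ι y := by
  have hr : vecMap R K (ν ⊕ ι) (Sum.elim 0 y) =
      Sum.elim (0 : ν → K) (vecMap R K ι y) := by
    ext i
    rcases i with i | i <;> simp [vecMap_apply]
  have hC : (-C).map (algebraMap R K) = -C.map (algebraMap R K) := by
    ext i j
    simp
  rw [Matrix.fromBlocks_map, Matrix.fromBlocks_mulVec, hr, Sum.elim_eq_iff, hC, Matrix.mulVec_neg,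
    Matrix.neg_mulVec, neg_eq_iff_add_eq_zero]
  refine and_congr_right fun h => ?_
  have h' : A.map (algebraMap R K) *ᵥ (-(w ∘ Sum.inl)) =
      B.map (algebraMap R K) *ᵥ (w ∘ Sum.inr) := by
    rw [Matrix.mulVec_neg, neg_eq_iff_add_eq_zero, h]
  rw [mulVec_eq_of_state_eq hA hG h', Matrix.mulVec_neg, add_comm]

/-- The isomorphism is induced by y ↦ (0, y). Left coprimeness clears the top component of a vector
modulo P R^(ν ⊕ κ). For the kernel, y = Gv with v integral forces an integral state x, whence (0, y)
= P(-x, v) with an integral argument. -/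
theorem zeroModule_equiv_zeroModule_fromBlocks [Fintype ι]
    (hA : IsUnit (A.map (algebraMap R K)).det)
    (hG : G = D.map (algebraMap R K) +
      C.map (algebraMap R K) * (A.map (algebraMap R K))⁻¹ * B.map (algebraMap R K))
    {X : Matrix ν ν R} {Y : Matrix κ ν R} (hXY : A * X + B * Y = 1)
    {U : Matrix ν ν R} {V : Matrix ν ι R} (hUV : U * A + V * C = 1) :
    Nonempty (ZeroModule R G ≃ₗ[R]
      ZeroModule R ((Matrix.fromBlocks A B (-C) D).map (algebraMap R K))) := by
  set P := Matrix.fromBlocks A B (-C) D with hP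
  let g : (ι → R) →ₗ[R] (ν ⊕ ι → R) :=
    { toFun := fun y => Sum.elim 0 y
      map_add' := fun y z => by ext i; rcases i with i | i <;> simp
      map_smul' := fun s y => by ext i; rcases i with i | i <;> simp }
  refine subquotient_equiv g ?_ ?_ ?_
  · rintro y ⟨v, hv⟩
    obtain ⟨x, hx⟩ := exists_state_eq hA (B.map (algebraMap R K) *ᵥ v)
    exact ⟨Sum.elim (-x) v, (fromBlocks_mulVec_eq_iff hA hG).2
      ⟨by rw [Sum.elim_comp_inl, Sum.elim_comp_inr, neg_neg, hx], hv⟩⟩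
  · rintro z ⟨w, hw⟩
    replace hw : P.map (algebraMap R K) *ᵥ w = vecMap R K _ z := hw
    -- By AX + BY = 1 the top component of Pu is that of z, so z - Pu has the form (0, y).
    set u : ν ⊕ κ → R := Sum.elim (X *ᵥ (z ∘ Sum.inl)) (Y *ᵥ (z ∘ Sum.inl)) with hu
    have hz : z - P *ᵥ u = g ((z - P *ᵥ u) ∘ Sum.inr) := by
      ext i
      rcases i with i | i
      · have h : A *ᵥ (X *ᵥ (z ∘ Sum.inl)) + B *ᵥ (Y *ᵥ (z ∘ Sum.inl)) = z ∘ Sum.inl := by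
          rw [Matrix.mulVec_mulVec, Matrix.mulVec_mulVec, ← Matrix.add_mulVec, hXY,
            Matrix.one_mulVec]
        rw [hP, Matrix.fromBlocks_mulVec, hu, Sum.elim_comp_inl, Sum.elim_comp_inr, Pi.sub_apply,
          Sum.elim_inl, h]
        simp [g]
      · rfl
    refine ⟨(z - P *ᵥ u) ∘ Sum.inr, ?_, -u, ?_⟩
    · have h1 : P.map (algebraMap R K) *ᵥ (w - vecMap R K _ u) =
          vecMap R K _ (Sum.elim 0 ((z - P *ᵥ u) ∘ Sum.inr)) := by
        change _ = vecMap R K _ (g _)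
        rw [← hz, Matrix.mulVec_sub, hw, map_mulVec_vecMap, map_sub]
      exact ⟨_, ((fromBlocks_mulVec_eq_iff hA hG).1 h1).2⟩
    · change P.map (algebraMap R K) *ᵥ vecMap R K _ (-u) = _
      rw [← hz, map_mulVec_vecMap, Matrix.mulVec_neg, sub_sub_cancel_left]
  · intro y _
    constructor
    · rintro ⟨w, hw⟩
      exact ⟨w ∘ Sum.inr, ((fromBlocks_mulVec_eq_iff hA hG).1 hw).2⟩
    · rintro ⟨v, hv⟩
      obtain ⟨x, hx⟩ := exists_state_eq hA (B.map (algebraMap R K) *ᵥ vecMap R K κ v)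
      obtain ⟨x, rfl⟩ := exists_vecMap_eq_of_mem_integralDomain hA hG hUV ⟨y, hv.symm⟩ hx
      have h1 : vecMap R K _ (Sum.elim (-x) v) ∘ Sum.inl = -vecMap R K ν x := by
        ext i
        simp [vecMap_apply]
      have h2 : vecMap R K _ (Sum.elim (-x) v) ∘ Sum.inr = vecMap R K κ v := by
        ext i
        simp [vecMap_apply]
      exact ⟨Sum.elim (-x) v, (fromBlocks_mulVec_eq_iff hA hG).2
        ⟨by rw [h1, h2, neg_neg, hx], by rw [h2]; exact hv⟩⟩

end System

end Modules

/-! ### Invariance of the pole and zero modules under unimodular equivalence -/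

section UnimodularEquivalence

variable {R : Type*} [CommRing R] {K : Type*} [Field K] [Algebra R K]
  {ι κ : Type*} [Fintype ι] [DecidableEq ι] [Fintype κ] [DecidableEq κ]
  {L L' : Matrix ι ι R} {M M' : Matrix κ κ R}

theorem map_mul_map_eq_one (h : L * L' = 1) :
    L.map (algebraMap R K) * L'.map (algebraMap R K) = 1 := by
  rw [← Matrix.map_mul, h, Matrix.map_one _ (map_zero _) (map_one _)]

/-- The zero module lives on the output side, so it is transported by y ↦ Ly; M only permutes the
inputs, over R and over K alike. -/
theorem zeroModule_unimodular_equiv (hL : L * L' = 1) (hM : M * M' = 1) (G : Matrix ι κ K) :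
    Nonempty (ZeroModule R G ≃ₗ[R]
      ZeroModule R (L.map (algebraMap R K) * G * M.map (algebraMap R K))) := by
  have hL' : L' * L = 1 := mul_eq_one_comm.1 hL
  have hM' : M' * M = 1 := mul_eq_one_comm.1 hM
  have hmul : ∀ v : κ → K, (L.map (algebraMap R K) * G * M.map (algebraMap R K)) *ᵥ
      (M'.map (algebraMap R K) *ᵥ v) = L.map (algebraMap R K) *ᵥ (G *ᵥ v) := fun v => by
    rw [Matrix.mulVec_mulVec, Matrix.mul_assoc, map_mul_map_eq_one hM, Matrix.mul_one,
      Matrix.mulVec_mulVec]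
  have hmul' : ∀ v : κ → K, L'.map (algebraMap R K) *ᵥ
      ((L.map (algebraMap R K) * G * M.map (algebraMap R K)) *ᵥ v) =
        G *ᵥ (M.map (algebraMap R K) *ᵥ v) := fun v => by
    rw [Matrix.mulVec_mulVec, Matrix.mul_assoc, ← Matrix.mul_assoc, map_mul_map_eq_one hL',
      Matrix.one_mul, Matrix.mulVec_mulVec]
  refine subquotient_equiv L.mulVecLin ?_ ?_ ?_
  · rintro y ⟨v, hv⟩
    replace hv : G *ᵥ v = vecMap R K _ y := hv
    refine ⟨M'.map (algebraMap R K) *ᵥ v, (hmul v).trans ?_⟩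
    rw [hv, map_mulVec_vecMap, Matrix.mulVecLin_apply]
  · rintro z ⟨v, hv⟩
    refine ⟨L' *ᵥ z, ⟨M.map (algebraMap R K) *ᵥ v, (hmul' v).symm.trans ?_⟩, ?_⟩
    · rw [← map_mulVec_vecMap]
      exact congrArg _ hv
    · rw [Matrix.mulVecLin_apply, Matrix.mulVec_mulVec, hL, Matrix.one_mulVec, sub_self]
      exact zero_mem _
  · intro y _
    constructor
    · rintro ⟨v, hv⟩
      replace hv : _ *ᵥ vecMap R K _ v = vecMap R K _ (L *ᵥ y) := hv
      refine ⟨M *ᵥ v, ?_⟩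
      change G *ᵥ vecMap R K _ (M *ᵥ v) = _
      rw [← map_mulVec_vecMap, ← hmul', hv, map_mulVec_vecMap, Matrix.mulVec_mulVec, hL',
        Matrix.one_mulVec]
    · rintro ⟨v, hv⟩
      replace hv : G *ᵥ vecMap R K _ v = vecMap R K _ y := hv
      refine ⟨M' *ᵥ v, ?_⟩
      change _ *ᵥ vecMap R K _ (M' *ᵥ v) = vecMap R K _ (L *ᵥ y)
      rw [← map_mulVec_vecMap, hmul, hv, map_mulVec_vecMap]

/-- The pole module lives on the input side, so it is transported by v ↦ M⁻¹v; multiplication by L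
preserves integrality of outputs in both directions. -/
theorem poleModule_unimodular_equiv (hL : L * L' = 1) (hM : M * M' = 1) (G : Matrix ι κ K) :
    Nonempty (PoleModule R G ≃ₗ[R]
      PoleModule R (L.map (algebraMap R K) * G * M.map (algebraMap R K))) := by
  have hL' : L' * L = 1 := mul_eq_one_comm.1 hL
  have hM' : M' * M = 1 := mul_eq_one_comm.1 hM
  have hmul : ∀ v : κ → R, (L.map (algebraMap R K) * G * M.map (algebraMap R K)) *ᵥ
      vecMap R K _ (M' *ᵥ v) = L.map (algebraMap R K) *ᵥ (G *ᵥ vecMap R K _ v) := fun v => by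
    rw [← map_mulVec_vecMap, Matrix.mulVec_mulVec, Matrix.mul_assoc, map_mul_map_eq_one hM,
      Matrix.mul_one, Matrix.mulVec_mulVec]
  refine subquotient_equiv M'.mulVecLin (fun _ _ => trivial) ?_ ?_
  · intro z _
    refine ⟨M *ᵥ z, trivial, ?_⟩
    rw [Matrix.mulVecLin_apply, Matrix.mulVec_mulVec, hM', Matrix.one_mulVec, sub_self]
    exact zero_mem _
  · intro v _
    constructor
    · rintro ⟨y, hy⟩
      replace hy : vecMap R K _ y = _ *ᵥ vecMap R K _ (M' *ᵥ v) := hy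
      rw [hmul] at hy
      refine ⟨L' *ᵥ y, ?_⟩
      change _ = G *ᵥ vecMap R K _ v
      rw [← map_mulVec_vecMap, hy, Matrix.mulVec_mulVec, map_mul_map_eq_one hL',
        Matrix.one_mulVec]
    · rintro ⟨y, hy⟩
      replace hy : vecMap R K _ y = G *ᵥ vecMap R K _ v := hy
      refine ⟨L *ᵥ y, ?_⟩
      change _ = _ *ᵥ vecMap R K _ (M' *ᵥ v)
      rw [hmul, ← hy, map_mulVec_vecMap]

end UnimodularEquivalence

/-! ### The local ring at a point -/

section LocalRing

variable {F : Type*} [Field F]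

/-- A nonzero value at a means that the numerator does not vanish there, and the numerator is the
denominator of the inverse up to cancellation. -/
theorem isUnit_of_localEval_ne_zero {a : F} {f : localRing a} (hf : localEval a f ≠ 0) :
    IsUnit f := by
  have hf0 : (f : RatFunc F) ≠ 0 := fun h =>
    hf (by rw [(Subtype.ext h : f = 0), map_zero])
  have hf' : (f : RatFunc F).num.eval a ≠ 0 := by
    intro h
    apply hf
    rw [localEval_apply, RatFunc.eval]
    simp [Polynomial.eval₂_id, h]
  have hinv : (f : RatFunc F)⁻¹ ∈ localRing a := by
    rw [← RatFunc.num_div_denom (f : RatFunc F), inv_div]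
    exact definedAt_of_dvd (RatFunc.denom_div_dvd _ _) hf'
  exact IsUnit.of_mul_eq_one ⟨_, hinv⟩ (Subtype.ext (mul_inv_cancel₀ hf0))

/-- The element `λ - a` of the local ring at `a`. -/
def uniformizer (a : F) : localRing a := ⟨localParam a, localParam_mem a⟩

theorem uniformizer_ne_zero (a : F) : uniformizer a ≠ 0 := fun h =>
  localParam_ne_zero a (congrArg Subtype.val h)

theorem localEval_uniformizer (a : F) : localEval a (uniformizer a) = 0 := by
  rw [localEval_apply]
  change RatFunc.eval (RingHom.id F) a (localParam a) = 0
  rw [localParam_eq, RatFunc.eval_algebraMap]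
  simp

theorem algebraMap_localRing (a : F) (f : localRing a) :
    algebraMap (localRing a) (RatFunc F) f = f := rfl

/-- Write f = t^k u with u a unit: integrality of f gives k ≥ 0, and k = 0 would make f a unit, with
nonzero value. -/
theorem uniformizer_dvd_of_localEval_eq_zero {a : F} {f : localRing a}
    (hf : localEval a f = 0) : uniformizer a ∣ f := by
  by_cases hf0 : f = 0
  · exact hf0 ▸ dvd_zero _
  · obtain ⟨k, u, hu0, hu, hu', h⟩ := exists_eq_zpow_mul
      (fun h => hf0 (Subtype.ext h) : (f : RatFunc F) ≠ 0) a
    have hk : 0 ≤ k := by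
      refine nonneg_of_localParam_zpow_mem a ?_
      have : localParam a ^ k = f * u⁻¹ := by rw [h, mul_inv_cancel_right₀ hu0]
      rw [this]
      exact mul_mem f.2 hu'
    have hk0 : k ≠ 0 := by
      rintro rfl
      rw [zpow_zero, one_mul] at h
      have h1 : f * ⟨u⁻¹, hu'⟩ = 1 := Subtype.ext (by
        change (f : RatFunc F) * u⁻¹ = 1
        rw [h, mul_inv_cancel₀ hu0])
      have := congrArg (localEval a) h1
      rw [map_mul, hf, zero_mul, map_one] at this
      exact zero_ne_one this
    refine ⟨⟨localParam a ^ (k - 1) * u, mul_mem (localParam_zpow_mem a (by omega)) hu⟩,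
      Subtype.ext ?_⟩
    change (f : RatFunc F) = localParam a * (localParam a ^ (k - 1) * u)
    rw [h, ← mul_assoc, ← zpow_one_add₀ (localParam_ne_zero a), add_sub_cancel]

theorem span_uniformizer_isMaximal (a : F) : (Ideal.span {uniformizer a}).IsMaximal := by
  have hsurj : Function.Surjective (localEval a) := fun c =>
    ⟨⟨algebraMap F[X] (RatFunc F) (Polynomial.C c), definedAt_algebraMap _ _⟩, by
      rw [localEval_apply]
      change RatFunc.eval _ _ (algebraMap F[X] (RatFunc F) (Polynomial.C c)) = c
      rw [RatFunc.eval_algebraMap]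
      simp⟩
  have : Ideal.span {uniformizer a} = RingHom.ker (localEval a) := by
    ext f
    rw [Ideal.mem_span_singleton, RingHom.mem_ker]
    refine ⟨?_, uniformizer_dvd_of_localEval_eq_zero⟩
    rintro ⟨g, rfl⟩
    rw [map_mul, localEval_uniformizer, zero_mul]
  rw [this]
  exact RingHom.ker_isMaximal_of_surjective _ hsurj

theorem uniformizer_pow_dvd_iff {a : F} {f : localRing a} {n : ℕ} :
    uniformizer a ^ n ∣ f ↔ localParam a ^ (-(n : ℤ)) * (f : RatFunc F) ∈ localRing a := by
  have h0 := localParam_ne_zero a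
  constructor
  · rintro ⟨g, rfl⟩
    have : localParam a ^ (-(n : ℤ)) * ((uniformizer a ^ n * g : localRing a) : RatFunc F) = g := by
      change localParam a ^ (-(n : ℤ)) * (localParam a ^ n * (g : RatFunc F)) = g
      rw [← mul_assoc, ← zpow_natCast, ← zpow_add₀ h0, neg_add_cancel, zpow_zero, one_mul]
    rw [this]
    exact g.2
  · intro h
    refine ⟨⟨_, h⟩, Subtype.ext ?_⟩
    change (f : RatFunc F) = localParam a ^ n * (localParam a ^ (-(n : ℤ)) * (f : RatFunc F))
    rw [← mul_assoc, ← zpow_natCast, ← zpow_add₀ h0, add_neg_cancel, zpow_zero, one_mul]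

/-- Handles poles and zeros uniformly: for k ≤ 0 the left side is divisibility by 1 and the right
side is automatic. -/
theorem uniformizer_pow_toNat_dvd_iff {a : F} {f : localRing a} (k : ℤ) :
    uniformizer a ^ k.toNat ∣ f ↔ localParam a ^ (-k) * (f : RatFunc F) ∈ localRing a := by
  rcases le_total 0 k with hk | hk
  · rw [uniformizer_pow_dvd_iff, Int.toNat_of_nonneg hk]
  · rw [Int.toNat_of_nonpos hk, pow_zero]
    exact iff_of_true (one_dvd _) (mul_mem (localParam_zpow_mem a (by omega)) f.2)

theorem exists_mul_eq_one_of_localEval_det_ne_zero {ι : Type*} [Fintype ι] [DecidableEq ι] {a : F}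
    {N : Matrix ι ι (localRing a)} (hN : localEval a N.det ≠ 0) : ∃ N', N * N' = 1 :=
  ⟨N⁻¹, Matrix.mul_nonsing_inv _ (isUnit_of_localEval_ne_zero hN)⟩

theorem IsRegularAt.exists_unimodular {ι : Type*} [Fintype ι] [DecidableEq ι]
    {R : Matrix ι ι (RatFunc F)} {a : F} (h : IsRegularAt R a) :
    ∃ N N' : Matrix ι ι (localRing a), N * N' = 1 ∧
      N.map (algebraMap (localRing a) (RatFunc F)) = R := by
  obtain ⟨N, hN, hdet⟩ := isRegularAt_iff.1 h
  obtain ⟨N', hN'⟩ := exists_mul_eq_one_of_localEval_det_ne_zero hdet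
  exact ⟨N, N', hN', hN⟩

/-! ### Pole and zero modules of the local Smith–McMillan form -/

section LocalDiag

variable {p m r : ℕ}

theorem localDiag_mulVec (hm : r ≤ m) (ν : Fin r → ℤ) (a : F) (w : Fin m → RatFunc F) (i : Fin p) :
    (localDiag p m ν a *ᵥ w) i =
      if h : i.val < r then localParam a ^ ν ⟨i, h⟩ * w (Fin.castLE hm ⟨i, h⟩) else 0 := by
  rw [Matrix.mulVec, dotProduct]
  split_ifs with h
  · rw [Finset.sum_eq_single (Fin.castLE hm ⟨i, h⟩)]
    · simp [localDiag, h]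
    · intro j _ hj
      rw [localDiag, Matrix.of_apply, dif_neg, zero_mul]
      rintro ⟨h', _⟩
      exact hj (Fin.ext h'.symm)
    · simp
  · refine Finset.sum_eq_zero fun j _ => ?_
    rw [localDiag, Matrix.of_apply, dif_neg (fun h' => h h'.2), zero_mul]

/-- Coordinatewise, t^ν v is integral iff t^max(-ν,0) divides v. Coordinates beyond r meet zero
columns and impose no condition. -/
theorem poleModule_localDiag_equiv (hp : r ≤ p) (hm : r ≤ m) (ν : Fin r → ℤ) (a : F) :
    Nonempty (PoleModule (localRing a) (localDiag p m ν a) ≃ₗ[localRing a]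
      CyclicProduct (uniformizer a) fun k => (-ν k).toNat) := by
  refine subquotient_equiv_of_ker
    (cyclicProductMk (uniformizer a) (fun k => (-ν k).toNat) ∘ₗ
      LinearMap.funLeft _ _ (Fin.castLE hm)) ?_ ?_
  · intro q
    obtain ⟨x, rfl⟩ := cyclicProductMk_surjective _ _ q
    obtain ⟨v, hv⟩ := LinearMap.funLeft_surjective_of_injective (localRing a) (localRing a) _
      (Fin.castLE_injective hm) x
    exact ⟨v, trivial, by rw [LinearMap.comp_apply, hv]⟩
  · intro v _
    rw [LinearMap.comp_apply, cyclicProductMk_eq_zero_iff, mem_integralDomain]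
    simp only [uniformizer_pow_toNat_dvd_iff, neg_neg, LinearMap.funLeft_apply]
    constructor
    · intro h
      refine ⟨fun i => if hi : i.val < r then ⟨_, h ⟨i, hi⟩⟩ else 0, funext fun i => ?_⟩
      rw [localDiag_mulVec hm]
      by_cases hi : i.val < r
      · simp only [vecMap_apply, dif_pos hi]
        rfl
      · simp only [vecMap_apply, dif_neg hi, map_zero]
    · rintro ⟨y, hy⟩ k
      have h := congrFun hy (Fin.castLE hp k)
      rw [localDiag_mulVec hm, dif_pos (show (Fin.castLE hp k).val < r from k.2)] at h
      have hy' := (y (Fin.castLE hp k)).2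
      change ((y (Fin.castLE hp k) : localRing a) : RatFunc F) = _ at h
      rw [h] at hy'
      exact hy'

/-- The saturated image consists of the integral vectors supported on the first r coordinates, and R
∩ t^ν R = t^max(ν,0) R in each of these. -/
theorem zeroModule_localDiag_equiv (hp : r ≤ p) (hm : r ≤ m) (ν : Fin r → ℤ) (a : F) :
    Nonempty (ZeroModule (localRing a) (localDiag p m ν a) ≃ₗ[localRing a]
      CyclicProduct (uniformizer a) fun k => (ν k).toNat) := by
  have h0 := localParam_ne_zero a
  refine subquotient_equiv_of_ker
    (cyclicProductMk (uniformizer a) (fun k => (ν k).toNat) ∘ₗ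
      LinearMap.funLeft _ _ (Fin.castLE hp)) ?_ ?_
  · intro q
    obtain ⟨x, rfl⟩ := cyclicProductMk_surjective _ _ q
    refine ⟨fun i => if hi : i.val < r then x ⟨i, hi⟩ else 0,
      ⟨fun j => if hj : j.val < r then localParam a ^ (-ν ⟨j, hj⟩) * (x ⟨j, hj⟩ : RatFunc F)
        else 0, funext fun i => ?_⟩, ?_⟩
    · change (localDiag p m ν a *ᵥ _) i = _
      rw [localDiag_mulVec hm]
      by_cases hi : i.val < r
      · simp only [vecMap_apply, dif_pos hi, Fin.val_castLE]
        rw [← mul_assoc, ← zpow_add₀ h0, add_neg_cancel, zpow_zero, one_mul]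
        rfl
      · simp only [vecMap_apply, dif_neg hi, map_zero]
    · rw [LinearMap.comp_apply]
      congr 1
      ext k
      simp [LinearMap.funLeft_apply]
  · rintro y ⟨v, hv⟩
    replace hv : localDiag p m ν a *ᵥ v = vecMap _ _ _ y := hv
    rw [LinearMap.comp_apply, cyclicProductMk_eq_zero_iff, mem_integralImage]
    simp only [uniformizer_pow_toNat_dvd_iff, LinearMap.funLeft_apply]
    constructor
    · intro h
      refine ⟨fun j => if hj : j.val < r then ⟨_, h ⟨j, hj⟩⟩ else 0, funext fun i => ?_⟩
      rw [localDiag_mulVec hm]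
      by_cases hi : i.val < r
      · simp only [vecMap_apply, dif_pos hi, Fin.val_castLE]
        rw [algebraMap_localRing, ← mul_assoc, ← zpow_add₀ h0, add_neg_cancel, zpow_zero, one_mul]
        rfl
      -- Beyond row r, y vanishes because it already lies in the image over K.
      · rw [dif_neg hi, ← hv, localDiag_mulVec hm, dif_neg hi]
    · rintro ⟨w, hw⟩ k
      have h := congrFun hw (Fin.castLE hp k)
      rw [localDiag_mulVec hm, dif_pos (show (Fin.castLE hp k).val < r from k.2),
        vecMap_apply, algebraMap_localRing] at h
      change _ = ((y (Fin.castLE hp k) : localRing a) : RatFunc F) at h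
      rw [← h, ← mul_assoc]
      have : localParam a ^ (-ν k) * localParam a ^ ν ⟨(Fin.castLE hp k).val, k.2⟩ = 1 := by
        rw [← zpow_add₀ h0]
        simp
      rw [this, one_mul]
      exact (w _).2

end LocalDiag

/-! ### Reading elementary divisors off the pole and zero modules -/

section Orders

variable {p m : ℕ}

theorem poleModule_equiv_cyclicProduct (G : Matrix (Fin p) (Fin m) (RatFunc F)) (a : F) :
    Nonempty (PoleModule (localRing a) G ≃ₗ[localRing a]
      CyclicProduct (uniformizer a) fun k => (-invariantOrders G a k).toNat) := by
  obtain ⟨-, R₁, R₂, h₁, h₂, h⟩ := isInvariantOrders_invariantOrders G a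
  obtain ⟨L, L', hL, rfl⟩ := h₁.exists_unimodular
  obtain ⟨M, M', hM, rfl⟩ := h₂.exists_unimodular
  obtain ⟨e⟩ := poleModule_unimodular_equiv hL hM G
  rw [h] at e
  obtain ⟨e'⟩ := poleModule_localDiag_equiv (by simpa using G.rank_le_height)
    (by simpa using G.rank_le_width) (invariantOrders G a) a
  exact ⟨e.trans e'⟩

theorem zeroModule_equiv_cyclicProduct (G : Matrix (Fin p) (Fin m) (RatFunc F)) (a : F) :
    Nonempty (ZeroModule (localRing a) G ≃ₗ[localRing a]
      CyclicProduct (uniformizer a) fun k => (invariantOrders G a k).toNat) := by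
  obtain ⟨-, R₁, R₂, h₁, h₂, h⟩ := isInvariantOrders_invariantOrders G a
  obtain ⟨L, L', hL, rfl⟩ := h₁.exists_unimodular
  obtain ⟨M, M', hM, rfl⟩ := h₂.exists_unimodular
  obtain ⟨e⟩ := zeroModule_unimodular_equiv hL hM G
  rw [h] at e
  obtain ⟨e'⟩ := zeroModule_localDiag_equiv (by simpa using G.rank_le_height)
    (by simpa using G.rank_le_width) (invariantOrders G a) a
  exact ⟨e.trans e'⟩

/-- A polynomial matrix as a matrix over the local ring at `a`. -/
def toLocal {ι κ : Type*} (a : F) (M : Matrix ι κ F[X]) : Matrix ι κ (localRing a) :=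
  Matrix.of fun i j => ⟨algebraMap F[X] (RatFunc F) (M i j), definedAt_algebraMap _ _⟩

theorem map_toLocal {ι κ : Type*} (a : F) (M : Matrix ι κ F[X]) :
    (toLocal a M).map (algebraMap (localRing a) (RatFunc F)) = ofPolynomial M := rfl

theorem map_localEval_toLocal {ι κ : Type*} (a : F) (M : Matrix ι κ F[X]) :
    (toLocal a M).map (localEval a) = M.map (Polynomial.eval a) := by
  ext i j
  change RatFunc.eval _ _ (algebraMap F[X] (RatFunc F) (M i j)) = _
  rw [RatFunc.eval_algebraMap]
  rfl

/-- The local Smith–McMillan form of M is a product of three matrices over the local ring, so its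
diagonal entries t^νₖ are integral. -/
theorem invariantOrders_ofPolynomial_nonneg (M : Matrix (Fin p) (Fin m) F[X]) (a : F)
    (k : Fin (ofPolynomial M).rank) : 0 ≤ invariantOrders (ofPolynomial M) a k := by
  obtain ⟨-, R₁, R₂, h₁, h₂, h⟩ := isInvariantOrders_invariantOrders (ofPolynomial M) a
  obtain ⟨L, L', -, rfl⟩ := h₁.exists_unimodular
  obtain ⟨N, N', -, rfl⟩ := h₂.exists_unimodular
  rw [← map_toLocal a, ← Matrix.map_mul, ← Matrix.map_mul] at h
  have hp : (ofPolynomial M).rank ≤ p := by simpa using (ofPolynomial M).rank_le_height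
  have hm : (ofPolynomial M).rank ≤ m := by simpa using (ofPolynomial M).rank_le_width
  have h1 := congrFun (congrFun h (Fin.castLE hp k)) (Fin.castLE hm k)
  have h2 : localDiag p m (invariantOrders (ofPolynomial M) a) a (Fin.castLE hp k)
      (Fin.castLE hm k) = localParam a ^ invariantOrders (ofPolynomial M) a k := by
    simp [localDiag]
  apply nonneg_of_localParam_zpow_mem a
  rw [← h2]
  exact h1 ▸ Subtype.property _

theorem zeroElementaryDivisors_eq (G : Matrix (Fin p) (Fin m) (RatFunc F)) (a : F) :
    zeroElementaryDivisors G a =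
      (Finset.univ.filter fun i => (invariantOrders G a i).toNat ≠ 0).val.map
        fun i => (X - C a) ^ (invariantOrders G a i).toNat := by
  rw [zeroElementaryDivisors]
  congr 3
  ext i
  omega

theorem poleElementaryDivisors_eq (G : Matrix (Fin p) (Fin m) (RatFunc F)) (a : F) :
    poleElementaryDivisors G a =
      (Finset.univ.filter fun i => (-invariantOrders G a i).toNat ≠ 0).val.map
        fun i => (X - C a) ^ (-invariantOrders G a i).toNat := by
  rw [poleElementaryDivisors]
  congr 3
  ext i
  omega

theorem elementaryDivisors_eq_zeroElementaryDivisors (M : Matrix (Fin p) (Fin m) F[X]) (a : F) :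
    elementaryDivisors M a = zeroElementaryDivisors (ofPolynomial M) a := by
  rw [elementaryDivisors, zeroElementaryDivisors]
  congr 3
  ext i
  have := invariantOrders_ofPolynomial_nonneg M a i
  omega

theorem zeroElementaryDivisors_eq_of_equiv {p' m' : ℕ} {G : Matrix (Fin p) (Fin m) (RatFunc F)}
    {H : Matrix (Fin p') (Fin m') (RatFunc F)} {a : F}
    (e : ZeroModule (localRing a) G ≃ₗ[localRing a] ZeroModule (localRing a) H) :
    zeroElementaryDivisors G a = zeroElementaryDivisors H a := by
  obtain ⟨e₁⟩ := zeroModule_equiv_cyclicProduct G a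
  obtain ⟨e₂⟩ := zeroModule_equiv_cyclicProduct H a
  rw [zeroElementaryDivisors_eq, zeroElementaryDivisors_eq]
  exact filter_ne_zero_map_eq_of_sum_tsub_eq (sum_tsub_eq_of_cyclicProduct_equiv
    (uniformizer_ne_zero a) (span_uniformizer_isMaximal a) ((e₁.symm.trans e).trans e₂))
    fun n => (X - C a) ^ n

theorem poleElementaryDivisors_eq_of_equiv {p' m' : ℕ} {G : Matrix (Fin p) (Fin m) (RatFunc F)}
    {H : Matrix (Fin p') (Fin m') (RatFunc F)} {a : F}
    (e : PoleModule (localRing a) G ≃ₗ[localRing a] ZeroModule (localRing a) H) :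
    poleElementaryDivisors G a = zeroElementaryDivisors H a := by
  obtain ⟨e₁⟩ := poleModule_equiv_cyclicProduct G a
  obtain ⟨e₂⟩ := zeroModule_equiv_cyclicProduct H a
  rw [poleElementaryDivisors_eq, zeroElementaryDivisors_eq]
  exact filter_ne_zero_map_eq_of_sum_tsub_eq (sum_tsub_eq_of_cyclicProduct_equiv
    (uniformizer_ne_zero a) (span_uniformizer_isMaximal a) ((e₁.symm.trans e).trans e₂))
    fun n => (X - C a) ^ n

end Orders

/-! ### Minimality and coprimeness -/

section Minimality

theorem exists_right_inverse_of_rank_eq {ι κ : Type*} [Fintype ι] [DecidableEq ι] [Fintype κ]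
    {M : Matrix ι κ F} (h : M.rank = Fintype.card ι) : ∃ N : Matrix κ ι F, M * N = 1 := by
  rw [← Matrix.mulVec_surjective_iff_exists_right_inverse]
  have : LinearMap.range M.mulVecLin = ⊤ :=
    Submodule.eq_top_of_finrank_eq (by rw [Module.finrank_fintype_fun_eq_card, ← h]; rfl)
  exact LinearMap.range_eq_top.1 this

/-- A Nakayama-type lifting: take a right inverse of the value at a as a constant matrix. Its
product with M has value 1 at a, hence is invertible over the local ring, and its inverse corrects
the right inverse. -/
theorem exists_localRing_right_inverse {ι κ : Type*} [Fintype ι] [DecidableEq ι] [Fintype κ]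
    {a : F} {M : Matrix ι κ (localRing a)}
    (h : (M.map (localEval a)).rank = Fintype.card ι) :
    ∃ N : Matrix κ ι (localRing a), M * N = 1 := by
  obtain ⟨N, hN⟩ := exists_right_inverse_of_rank_eq h
  have hlift : (toLocal a (N.map Polynomial.C)).map (localEval a) = N := by
    rw [map_localEval_toLocal]
    ext i j
    simp
  obtain ⟨W, hW⟩ := exists_mul_eq_one_of_localEval_det_ne_zero
    (N := M * toLocal a (N.map Polynomial.C)) (by
      rw [RingHom.map_det, RingHom.mapMatrix_apply, Matrix.map_mul, hlift, hN, Matrix.det_one]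
      exact one_ne_zero)
  exact ⟨toLocal a (N.map Polynomial.C) * W, by rw [← Matrix.mul_assoc, hW]⟩

variable {n p m : ℕ} {P : PolynomialSystemMatrix F n p m} {a : F}

theorem PolynomialSystemMatrix.IsMinimalAt.exists_left_coprime (h : P.IsMinimalAt a) :
    ∃ (X : Matrix (Fin n) (Fin n) (localRing a)) (Y : Matrix (Fin m) (Fin n) (localRing a)),
      toLocal a P.A * X + toLocal a P.B * Y = 1 := by
  obtain ⟨N, hN⟩ := exists_localRing_right_inverse (a := a)
    (M := Matrix.fromCols (toLocal a P.A) (toLocal a P.B)) (by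
      rw [Fintype.card_fin, Matrix.fromCols_map, map_localEval_toLocal, map_localEval_toLocal]
      exact h.2)
  refine ⟨N.toRows₁, N.toRows₂, ?_⟩
  rw [← Matrix.fromCols_mul_fromRows, Matrix.fromRows_toRows, hN]

theorem PolynomialSystemMatrix.IsMinimalAt.exists_right_coprime (h : P.IsMinimalAt a) :
    ∃ (U : Matrix (Fin n) (Fin n) (localRing a)) (V : Matrix (Fin n) (Fin p) (localRing a)),
      U * toLocal a P.A + V * toLocal a P.C = 1 := by
  obtain ⟨N, hN⟩ := exists_localRing_right_inverse (a := a)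
    -- A left inverse of [A; C] is the transpose of a right inverse of its transpose.
    (M := (Matrix.fromRows (toLocal a P.A) (toLocal a P.C))ᵀ) (by
      rw [Fintype.card_fin, Matrix.transpose_map, Matrix.rank_transpose, Matrix.fromRows_map,
        map_localEval_toLocal, map_localEval_toLocal]
      exact h.1)
  have hN' := congrArg Matrix.transpose hN
  rw [Matrix.transpose_mul, Matrix.transpose_transpose, Matrix.transpose_one] at hN'
  refine ⟨Nᵀ.toCols₁, Nᵀ.toCols₂, ?_⟩
  rw [← Matrix.fromCols_mul_fromRows, Matrix.fromCols_toCols, hN']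

end Minimality

end LocalRing

end RationalMatrix

end

/-! ### The main theorem -/

theorem theorem3p1 {F : Type*} [Field F] [IsAlgClosed F] {n p m : ℕ} (lam₀ : F)
    (G : Matrix (Fin p) (Fin m) (RatFunc F))
    (P : RationalMatrix.PolynomialSystemMatrix F n p m)
    (hG : P.transferFunction = G) (hmin : P.IsMinimalAt lam₀) :
    RationalMatrix.elementaryDivisors P.A lam₀ =
        RationalMatrix.poleElementaryDivisors G lam₀ ∧
      RationalMatrix.elementaryDivisors P.toMatrix lam₀ =
        RationalMatrix.zeroElementaryDivisors G lam₀ := by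
  open RationalMatrix in
  obtain ⟨X, Y, hXY⟩ := hmin.exists_left_coprime
  obtain ⟨U, V, hUV⟩ := hmin.exists_right_coprime
  have hA : IsUnit ((toLocal lam₀ P.A).map
      (algebraMap (localRing lam₀) (RatFunc F))).det := by
    rw [map_toLocal]
    change IsUnit ((algebraMap F[X] (RatFunc F)).mapMatrix P.A).det
    rw [← RingHom.map_det]
    exact (RatFunc.algebraMap_ne_zero P.det_A_ne_zero).isUnit
  have hG' : G = (toLocal lam₀ P.D).map (algebraMap (localRing lam₀) (RatFunc F)) +
      (toLocal lam₀ P.C).map (algebraMap _ _) *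
        ((toLocal lam₀ P.A).map (algebraMap _ _))⁻¹ *
        (toLocal lam₀ P.B).map (algebraMap _ _) := hG.symm
  obtain ⟨e₁⟩ := poleModule_equiv_zeroModule hA hG' hXY hUV
  obtain ⟨e₂⟩ := zeroModule_equiv_zeroModule_fromBlocks hA hG' hXY hUV
  obtain ⟨e₃⟩ := zeroModule_submatrix_equiv (R := localRing lam₀)
    ((Matrix.fromBlocks (toLocal lam₀ P.A) (toLocal lam₀ P.B) (-toLocal lam₀ P.C)
      (toLocal lam₀ P.D)).map (algebraMap (localRing lam₀) (RatFunc F)))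
    (finSumFinEquiv (m := n) (n := p)).symm (finSumFinEquiv (m := n) (n := m)).symm
  have hP : ((Matrix.fromBlocks (toLocal lam₀ P.A) (toLocal lam₀ P.B) (-toLocal lam₀ P.C)
      (toLocal lam₀ P.D)).map (algebraMap (localRing lam₀) (RatFunc F))).submatrix
      (finSumFinEquiv (m := n) (n := p)).symm (finSumFinEquiv (m := n) (n := m)).symm =
      ofPolynomial P.toMatrix := by
    have hC : (-toLocal lam₀ P.C).map (algebraMap (localRing lam₀) (RatFunc F)) =
        ofPolynomial (-P.C) := by
      ext i j
      simp [ofPolynomial, toLocal, algebraMap_localRing]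
    rw [PolynomialSystemMatrix.toMatrix, ofPolynomial, Matrix.reindex_apply, ← Matrix.submatrix_map,
      Matrix.fromBlocks_map, Matrix.fromBlocks_map, hC]
    rfl
  rw [hP] at e₃
  -- Both A and P are polynomial, so only their zero modules matter.
  rw [elementaryDivisors_eq_zeroElementaryDivisors, elementaryDivisors_eq_zeroElementaryDivisors]
  exact ⟨(poleElementaryDivisors_eq_of_equiv e₁).symm,
    (zeroElementaryDivisors_eq_of_equiv (e₂.trans e₃)).symm⟩
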